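/- Let $A$ be a separable (not necessarily unital) $C^*$-algebra, and let $T(A)$ be its set of tracial states with the weak$^*$-topology; assume $T(A)$ is non-empty and compact. Put $\|a\|_{2,T(A)}=\sup_{\tau\in T(A)}\tau(a^*a)^{1/2}$ for $a\in A$. Fix a free ultrafilter $\omega$ on $\mathbb N$ and let $$A^\omega=\ell^\infty(A)\big/\{(a_n)_n:\lim_{n\to\omega}\|a_n\|_{2,T(A)}=0\}$$ be the uniform tracial ultrapower, with $\iota:A\to A^\omega$ the $^*$-homomorphism given by constant sequences; for $a\in A$ write $a$ also for $\iota(a)$, and write $A^\omega\cap A'$ for the commutant $A^\omega\cap\iota(A)'$. A limit trace is a functional on $A^\omega$ of the form $(a_n)_n\mapsto\lim_{n\to\omega}\tau_n(a_n)$ for a sequence $(\tau_n)_n$ in $T(A)$; let $T_\omega(A)$ be the set of limit traces and $\|x\|_{2,T_\omega(A)}=\sup_{\tau\in T_\omega(A)}\tau(x^*x)^{1/2}$ for $x\in A^\omega$. Then the following are equivalent. (i) $A$ has uniform property $\Gamma$: for every integer $n\ge1$ there exist projections $p_1,\dots,p_n\in A^\omega\cap A'$ with $p_1+\dots+p_n=1_{A^\omega}$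 and $$\tau(ap_i)=\tfrac1n\tau(a),\qquad a\in A,\ \tau\in T_\omega(A),\ i=1,\dots,n.$$ (ii) For some $0<\lambda<1$ there exists a projection $p\in A^\omega\cap A'$ such that $$\tau(ap)=\lambda\tau(a),\qquad a\in A,\ \tau\in T_\omega(A).$$ (iii) For every $\|\cdot\|_{2,T_\omega(A)}$-separable $^*$-subalgebra $S\subset A^\omega$ there is a unital $^*$-homomorphism $\phi:L^\infty([0,1])\to A^\omega\cap S'$ such that $$\tau(a\phi(f))=\tau(a)\int_0^1 f(t)\,dt,\qquad a\in S,\ f\in L^\infty([0,1]),\ \tau\in T_\omega(A).$$ -/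

import Mathlib

open scoped ENNReal

noncomputable section

namespace UniformGamma

/-! ### Traces and the uniform 2-seminorm -/

section Traces

open scoped ComplexOrder

variable (A : Type*) [NonUnitalCStarAlgebra A]

/-- `T(A)`: the tracial states (positive functionals of norm one with `τ (ab) = τ (ba)`) of the
(possibly non-unital) C⋆-algebra `A`, as a subset of the dual of `A` with the weak⋆ topology. -/
def TraceSpace : Set (WeakDual ℂ A) :=
  {τ | (∀ a : A, 0 ≤ τ (star a * a)) ∧ ‖WeakDual.toStrongDual τ‖ = 1 ∧
    ∀ a b : A, τ (a * b) = τ (b * a)}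

variable {A}

/-- The seminorm `‖a‖_{2,τ} = τ(a⋆a)^{1/2}` of a positive functional `τ`. -/
def twoNorm {B : Type*} [Mul B] [Star B] (τ : B → ℂ) (b : B) : ℝ :=
  √(τ (star b * b)).re

/-- The uniform trace seminorm `‖a‖_{2,T(A)} = sup_{τ ∈ T(A)} ‖a‖_{2,τ}` (the family is bounded,
see `bddAbove_twoNorm`). -/
def uniformTwoNorm (a : A) : ℝ := ⨆ τ : TraceSpace A, twoNorm (τ : WeakDual ℂ A) a

section Aux

attribute [local instance] CStarAlgebra.spectralOrder CStarAlgebra.spectralOrderedRing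

/-- A tracial state as a positive linear map, for the canonical order of `A`. -/
def toPositive (τ : TraceSpace A) : A →ₚ[ℂ] ℂ :=
  PositiveLinearMap.mk₀ ((τ : WeakDual ℂ A) : A →ₗ[ℂ] ℂ) fun a ha => by
    obtain ⟨b, rfl⟩ := CStarAlgebra.nonneg_iff_eq_star_mul_self.mp ha
    exact τ.2.1 b

lemma norm_toPreGNS (τ : TraceSpace A) (a : A) :
    ‖(toPositive τ).toPreGNS a‖ = twoNorm (τ : WeakDual ℂ A) a := rfl

lemma twoNorm_add_le (τ : TraceSpace A) (a b : A) :
    twoNorm (τ : WeakDual ℂ A) (a + b)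
      ≤ twoNorm (τ : WeakDual ℂ A) a + twoNorm (τ : WeakDual ℂ A) b := by
  simpa only [← norm_toPreGNS, map_add] using norm_add_le _ _

lemma twoNorm_smul (τ : TraceSpace A) (c : ℂ) (a : A) :
    twoNorm (τ : WeakDual ℂ A) (c • a) = ‖c‖ * twoNorm (τ : WeakDual ℂ A) a := by
  simpa only [← norm_toPreGNS, map_smul] using norm_smul _ _

lemma twoNorm_mul_le_left (τ : TraceSpace A) (a b : A) :
    twoNorm (τ : WeakDual ℂ A) (a * b) ≤ ‖a‖ * twoNorm (τ : WeakDual ℂ A) b :=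
  LinearMap.mkContinuous_norm_le _ (norm_nonneg a) _ |> fun h =>
    ((toPositive τ).leftMulMapPreGNS a).le_of_opNorm_le h ((toPositive τ).toPreGNS b)

lemma twoNorm_star (τ : TraceSpace A) (a : A) :
    twoNorm (τ : WeakDual ℂ A) (star a) = twoNorm (τ : WeakDual ℂ A) a := by
  simp only [twoNorm, star_star, τ.2.2.2 a (star a)]

lemma norm_apply_le (τ : TraceSpace A) (a : A) : ‖(τ : WeakDual ℂ A) a‖ ≤ ‖a‖ := by
  have h := (WeakDual.toStrongDual (τ : WeakDual ℂ A)).le_opNorm a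
  rw [τ.2.2.1, one_mul] at h
  exact h

lemma twoNorm_le_norm (τ : TraceSpace A) (a : A) : twoNorm (τ : WeakDual ℂ A) a ≤ ‖a‖ := by
  refine Real.sqrt_le_iff.2 ⟨norm_nonneg a, (Complex.re_le_norm _).trans ?_⟩
  refine (norm_apply_le τ _).trans ?_
  rw [CStarRing.norm_star_mul_self, sq]

lemma norm_apply_mul_le (τ : TraceSpace A) (a b : A) :
    ‖(τ : WeakDual ℂ A) (a * b)‖
      ≤ twoNorm (τ : WeakDual ℂ A) a * twoNorm (τ : WeakDual ℂ A) b := by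
  have h := norm_inner_le_norm (𝕜 := ℂ) ((toPositive τ).toPreGNS (star a))
    ((toPositive τ).toPreGNS b)
  rw [norm_toPreGNS, norm_toPreGNS, twoNorm_star, PositiveLinearMap.preGNS_inner_def] at h
  simp only [PositiveLinearMap.ofPreGNS_toPreGNS, star_star] at h
  exact h

open Filter Topology in
/-- The Cauchy–Schwarz bound `|τ(a)| ≤ ‖a‖_{2,τ}`. -/
lemma norm_apply_le_twoNorm (τ : TraceSpace A) (a : A) :
    ‖(τ : WeakDual ℂ A) a‖ ≤ twoNorm (τ : WeakDual ℂ A) a := by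
  have hl := CStarAlgebra.increasingApproximateUnit A
  have := hl.neBot
  have ht : Tendsto (fun e => ‖(τ : WeakDual ℂ A) (e * a)‖) (CStarAlgebra.approximateUnit A)
      (𝓝 ‖(τ : WeakDual ℂ A) a‖) :=
    (((WeakDual.toStrongDual (τ : WeakDual ℂ A)).continuous.tendsto a).comp
      (hl.tendsto_mul_right a)).norm
  refine le_of_tendsto ht ?_
  filter_upwards [hl.eventually_norm] with e he
  refine (norm_apply_mul_le τ e a).trans ?_
  exact mul_le_of_le_one_left (Real.sqrt_nonneg _) ((twoNorm_le_norm τ e).trans he)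

end Aux

lemma bddAbove_twoNorm (a : A) :
    BddAbove (Set.range fun τ : TraceSpace A => twoNorm (τ : WeakDual ℂ A) a) :=
  ⟨‖a‖, by rintro _ ⟨τ, rfl⟩; exact twoNorm_le_norm τ a⟩

lemma twoNorm_le_uniform (τ : TraceSpace A) (a : A) :
    twoNorm (τ : WeakDual ℂ A) a ≤ uniformTwoNorm a :=
  le_ciSup (bddAbove_twoNorm a) τ

lemma uniformTwoNorm_nonneg (a : A) : 0 ≤ uniformTwoNorm a :=
  Real.iSup_nonneg fun _ => Real.sqrt_nonneg _

lemma uniformTwoNorm_le {a : A} {C : ℝ} (hC : 0 ≤ C)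
    (h : ∀ τ : TraceSpace A, twoNorm (τ : WeakDual ℂ A) a ≤ C) : uniformTwoNorm a ≤ C :=
  Real.iSup_le h hC

lemma uniformTwoNorm_add_le (a b : A) :
    uniformTwoNorm (a + b) ≤ uniformTwoNorm a + uniformTwoNorm b :=
  uniformTwoNorm_le (add_nonneg (uniformTwoNorm_nonneg a) (uniformTwoNorm_nonneg b)) fun τ =>
    (twoNorm_add_le τ a b).trans (add_le_add (twoNorm_le_uniform τ a) (twoNorm_le_uniform τ b))

lemma uniformTwoNorm_smul_le (c : ℂ) (a : A) :
    uniformTwoNorm (c • a) ≤ ‖c‖ * uniformTwoNorm a :=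
  uniformTwoNorm_le (mul_nonneg (norm_nonneg c) (uniformTwoNorm_nonneg a)) fun τ =>
    (twoNorm_smul τ c a).le.trans
      (mul_le_mul_of_nonneg_left (twoNorm_le_uniform τ a) (norm_nonneg c))

lemma uniformTwoNorm_star (a : A) : uniformTwoNorm (star a) = uniformTwoNorm a := by
  simp only [uniformTwoNorm, twoNorm_star]

lemma uniformTwoNorm_mul_le_left (a b : A) :
    uniformTwoNorm (a * b) ≤ ‖a‖ * uniformTwoNorm b :=
  uniformTwoNorm_le (mul_nonneg (norm_nonneg a) (uniformTwoNorm_nonneg b)) fun τ =>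
    (twoNorm_mul_le_left τ a b).trans
      (mul_le_mul_of_nonneg_left (twoNorm_le_uniform τ b) (norm_nonneg a))

lemma uniformTwoNorm_mul_le_right (a b : A) :
    uniformTwoNorm (a * b) ≤ ‖b‖ * uniformTwoNorm a := by
  rw [← uniformTwoNorm_star, star_mul, ← norm_star b, ← uniformTwoNorm_star a]
  exact uniformTwoNorm_mul_le_left _ _

end Traces

/-! ### The uniform tracial ultrapower -/

section Ultrapower

open Filter Topology

variable (A : Type*) [NonUnitalCStarAlgebra A] (ω : Ultrafilter ℕ)

/-- `ℓ^∞(A)`, the C⋆-algebra of bounded sequences in `A`. -/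
abbrev BoundedSeq : Type _ := lp (fun _ : ℕ => A) ∞

/-- The ideal of bounded sequences `(a_n)` with `lim_{n → ω} ‖a_n‖_{2,T(A)} = 0`. -/
def traceNull : Submodule ℂ (BoundedSeq A) where
  carrier := {a | Tendsto (fun n => uniformTwoNorm (a n)) ω (𝓝 0)}
  zero_mem' := by
    have : ∀ n, uniformTwoNorm ((0 : BoundedSeq A) n) = 0 := fun n =>
      le_antisymm (by simpa using uniformTwoNorm_smul_le (0 : ℂ) (0 : A)) (uniformTwoNorm_nonneg _)
    change Tendsto (fun n => uniformTwoNorm ((0 : BoundedSeq A) n)) ω (𝓝 0)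
    simp only [this]
    exact tendsto_const_nhds
  add_mem' {a b} ha hb := by
    refine squeeze_zero (fun n => uniformTwoNorm_nonneg _)
      (fun n => uniformTwoNorm_add_le (a n) (b n)) ?_
    simpa using Tendsto.add ha hb
  smul_mem' c a ha := by
    refine squeeze_zero (fun n => uniformTwoNorm_nonneg _)
      (fun n => uniformTwoNorm_smul_le c (a n)) ?_
    simpa using Tendsto.const_mul ‖c‖ ha

variable {A ω}

lemma mem_traceNull {a : BoundedSeq A} :
    a ∈ traceNull A ω ↔ Tendsto (fun n => uniformTwoNorm (a n)) ω (𝓝 0) := Iff.rfl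

lemma mul_mem_traceNull_left (x : BoundedSeq A) {a : BoundedSeq A} (ha : a ∈ traceNull A ω) :
    x * a ∈ traceNull A ω := by
  refine squeeze_zero (fun n => uniformTwoNorm_nonneg _) (fun n => ?_)
    (by simpa using Tendsto.const_mul ‖x‖ ha)
  exact (uniformTwoNorm_mul_le_left (x n) (a n)).trans
    (mul_le_mul_of_nonneg_right (lp.norm_apply_le_norm ENNReal.top_ne_zero x n)
      (uniformTwoNorm_nonneg _))

lemma mul_mem_traceNull_right (x : BoundedSeq A) {a : BoundedSeq A} (ha : a ∈ traceNull A ω) :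
    a * x ∈ traceNull A ω := by
  refine squeeze_zero (fun n => uniformTwoNorm_nonneg _) (fun n => ?_)
    (by simpa using Tendsto.const_mul ‖x‖ ha)
  exact (uniformTwoNorm_mul_le_right (a n) (x n)).trans
    (mul_le_mul_of_nonneg_right (lp.norm_apply_le_norm ENNReal.top_ne_zero x n)
      (uniformTwoNorm_nonneg _))

lemma star_mem_traceNull {a : BoundedSeq A} (ha : a ∈ traceNull A ω) :
    star a ∈ traceNull A ω := by
  simpa only [mem_traceNull, lp.star_apply, uniformTwoNorm_star] using ha

variable (A ω)

/-- The uniform tracial ultrapower `A^ω = ℓ^∞(A) / {(a_n) : lim_{n → ω} ‖a_n‖_{2,T(A)} = 0}`,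
with the ⋆-algebra operations induced from the termwise ones. -/
def Ultrapower : Type _ := BoundedSeq A ⧸ traceNull A ω

instance : AddCommGroup (Ultrapower A ω) :=
  inferInstanceAs (AddCommGroup (BoundedSeq A ⧸ traceNull A ω))

instance : Module ℂ (Ultrapower A ω) :=
  inferInstanceAs (Module ℂ (BoundedSeq A ⧸ traceNull A ω))

/-- The quotient map `ℓ^∞(A) → A^ω`. -/
def mk : BoundedSeq A →ₗ[ℂ] Ultrapower A ω := (traceNull A ω).mkQ

variable {A ω}

lemma mk_surjective : Function.Surjective (mk A ω) := (traceNull A ω).mkQ_surjective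

lemma mk_eq_mk {a b : BoundedSeq A} : mk A ω a = mk A ω b ↔ a - b ∈ traceNull A ω :=
  Submodule.Quotient.eq _

instance : Mul (Ultrapower A ω) where
  mul := Quotient.map₂ (· * ·) fun a a' ha b b' hb => by
    have ha' : a - a' ∈ traceNull A ω := (Submodule.quotientRel_def _).1 ha
    have hb' : b - b' ∈ traceNull A ω := (Submodule.quotientRel_def _).1 hb
    refine (Submodule.quotientRel_def _).2 ?_
    have : a * b - a' * b' = (a - a') * b + a' * (b - b') := by
      rw [sub_mul, mul_sub]; abel
    rw [this]
    exact add_mem (mul_mem_traceNull_right b ha') (mul_mem_traceNull_left a' hb')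

instance : Star (Ultrapower A ω) where
  star := Quotient.map star fun a a' ha => by
    have ha' : a - a' ∈ traceNull A ω := (Submodule.quotientRel_def _).1 ha
    refine (Submodule.quotientRel_def _).2 ?_
    rw [← star_sub]
    exact star_mem_traceNull ha'

lemma mk_mul (a b : BoundedSeq A) : mk A ω (a * b) = mk A ω a * mk A ω b := rfl

lemma mk_star (a : BoundedSeq A) : mk A ω (star a) = star (mk A ω a) := rfl

instance : NonUnitalRing (Ultrapower A ω) where
  left_distrib x y z := by
    obtain ⟨a, rfl⟩ := mk_surjective x
    obtain ⟨b, rfl⟩ := mk_surjective y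
    obtain ⟨c, rfl⟩ := mk_surjective z
    simp only [← map_add, ← mk_mul, mul_add]
  right_distrib x y z := by
    obtain ⟨a, rfl⟩ := mk_surjective x
    obtain ⟨b, rfl⟩ := mk_surjective y
    obtain ⟨c, rfl⟩ := mk_surjective z
    simp only [← map_add, ← mk_mul, add_mul]
  zero_mul x := by
    obtain ⟨a, rfl⟩ := mk_surjective x
    rw [← map_zero (mk A ω), ← mk_mul, zero_mul]
  mul_zero x := by
    obtain ⟨a, rfl⟩ := mk_surjective x
    rw [← map_zero (mk A ω), ← mk_mul, mul_zero]
  mul_assoc x y z := by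
    obtain ⟨a, rfl⟩ := mk_surjective x
    obtain ⟨b, rfl⟩ := mk_surjective y
    obtain ⟨c, rfl⟩ := mk_surjective z
    simp only [← mk_mul, mul_assoc]

instance : StarRing (Ultrapower A ω) where
  star_involutive x := by
    obtain ⟨a, rfl⟩ := mk_surjective x
    simp only [← mk_star, star_star]
  star_mul x y := by
    obtain ⟨a, rfl⟩ := mk_surjective x
    obtain ⟨b, rfl⟩ := mk_surjective y
    simp only [← mk_star, ← mk_mul, star_mul]
  star_add x y := by
    obtain ⟨a, rfl⟩ := mk_surjective x
    obtain ⟨b, rfl⟩ := mk_surjective y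
    simp only [← mk_star, ← map_add, star_add]

instance : StarModule ℂ (Ultrapower A ω) where
  star_smul c x := by
    obtain ⟨a, rfl⟩ := mk_surjective x
    simp only [← mk_star, ← map_smul, star_smul]

instance : IsScalarTower ℂ (Ultrapower A ω) (Ultrapower A ω) where
  smul_assoc c x y := by
    obtain ⟨a, rfl⟩ := mk_surjective x
    obtain ⟨b, rfl⟩ := mk_surjective y
    simp only [smul_eq_mul, ← mk_mul, ← map_smul, smul_mul_assoc]

instance : SMulCommClass ℂ (Ultrapower A ω) (Ultrapower A ω) where
  smul_comm c x y := by
    obtain ⟨a, rfl⟩ := mk_surjective x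
    obtain ⟨b, rfl⟩ := mk_surjective y
    simp only [smul_eq_mul, ← mk_mul, ← map_smul, mul_smul_comm]

/-- The constant sequence with value `a`. -/
def constSeq (a : A) : BoundedSeq A :=
  ⟨fun _ => a, memℓp_infty ⟨‖a‖, by rintro _ ⟨_, rfl⟩; exact le_rfl⟩⟩

variable (A ω) in
/-- The canonical ⋆-homomorphism `ι : A → A^ω` given by constant sequences. -/
def iota : A →⋆ₙₐ[ℂ] Ultrapower A ω where
  toFun a := mk A ω (constSeq a)
  map_smul' c a := map_smul (mk A ω) c (constSeq a)
  map_zero' := map_zero (mk A ω)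
  map_add' a b := map_add (mk A ω) (constSeq a) (constSeq b)
  map_mul' a b := mk_mul (constSeq a) (constSeq b)
  map_star' a := mk_star (constSeq a)

/-! ### Limit traces -/

/-- For `τ_n ∈ T(A)` and a bounded sequence `(a_n)` the limit of `τ_n(a_n)` along `ω` exists. -/
lemma tendsto_limUnder (τ : ℕ → TraceSpace A) (a : BoundedSeq A) :
    Tendsto (fun n => (τ n : WeakDual ℂ A) (a n)) ω
      (𝓝 (limUnder (ω : Filter ℕ) fun n => (τ n : WeakDual ℂ A) (a n))) := by
  have hb : ∀ n, (τ n : WeakDual ℂ A) (a n) ∈ Metric.closedBall (0 : ℂ) ‖a‖ := fun n => by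
    rw [mem_closedBall_zero_iff]
    exact (norm_apply_le (τ n) (a n)).trans (lp.norm_apply_le_norm ENNReal.top_ne_zero a n)
  obtain ⟨z, -, hz⟩ := (isCompact_closedBall (0 : ℂ) ‖a‖).ultrafilter_le_nhds
    (ω.map fun n => (τ n : WeakDual ℂ A) (a n))
    (by rw [le_principal_iff]; exact Filter.mem_map.2 (Filter.univ_mem' hb))
  exact tendsto_nhds_limUnder ⟨z, hz⟩

variable (ω) in
/-- The trace `(a_n) ↦ lim_{n → ω} τ_n(a_n)` on `ℓ^∞(A)`. -/
def limitTraceSeq (τ : ℕ → TraceSpace A) : BoundedSeq A →ₗ[ℂ] ℂ where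
  toFun a := limUnder (ω : Filter ℕ) fun n => (τ n : WeakDual ℂ A) (a n)
  map_add' a b := by
    refine Tendsto.limUnder_eq ?_
    simpa only [lp.coeFn_add, Pi.add_apply, map_add] using
      (tendsto_limUnder τ a).add (tendsto_limUnder τ b)
  map_smul' c a := by
    refine Tendsto.limUnder_eq ?_
    simpa only [lp.coeFn_smul, Pi.smul_apply, map_smul, RingHom.id_apply] using
      (tendsto_limUnder τ a).const_smul c

variable (ω) in
/-- The limit trace on `A^ω` induced by a sequence `(τ_n)` in `T(A)`. -/
def limitTrace (τ : ℕ → TraceSpace A) : Ultrapower A ω →ₗ[ℂ] ℂ :=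
  (traceNull A ω).liftQ (limitTraceSeq ω τ) fun a ha => by
    refine LinearMap.mem_ker.2 (Tendsto.limUnder_eq ?_)
    exact squeeze_zero_norm (fun n => (norm_apply_le_twoNorm (τ n) (a n)).trans
      (twoNorm_le_uniform (τ n) (a n))) ha

lemma tendsto_limitTrace (τ : ℕ → TraceSpace A) (a : BoundedSeq A) :
    Tendsto (fun n => (τ n : WeakDual ℂ A) (a n)) ω (𝓝 (limitTrace ω τ (mk A ω a))) :=
  tendsto_limUnder τ a

variable (A ω) in
/-- `T_ω(A)`: the set of limit traces on `A^ω`. -/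
def LimitTraces : Set (Ultrapower A ω →ₗ[ℂ] ℂ) := Set.range (limitTrace ω)

/-- The norm `‖x‖_{2,T_ω(A)} = sup_{τ ∈ T_ω(A)} τ(x⋆x)^{1/2}` on `A^ω` (the family is bounded, see
`bddAbove_limitTrace`). -/
def limitTwoNorm (x : Ultrapower A ω) : ℝ := ⨆ τ : LimitTraces A ω, twoNorm τ.1 x

lemma bddAbove_limitTrace (x : Ultrapower A ω) :
    BddAbove (Set.range fun τ : LimitTraces A ω => twoNorm τ.1 x) := by
  obtain ⟨a, rfl⟩ := mk_surjective x
  refine ⟨‖a‖, ?_⟩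
  rintro _ ⟨⟨_, τ, rfl⟩, rfl⟩
  refine Real.sqrt_le_iff.2 ⟨norm_nonneg a, (Complex.re_le_norm _).trans ?_⟩
  refine le_of_tendsto (tendsto_limitTrace τ (star a * a)).norm (Eventually.of_forall fun n => ?_)
  refine (norm_apply_le (τ n) _).trans
    ((lp.norm_apply_le_norm ENNReal.top_ne_zero (star a * a) n).trans ?_)
  rw [CStarRing.norm_star_mul_self, sq]

/-- Separability of a subset of `A^ω` with respect to `‖·‖_{2,T_ω(A)}`. -/
def IsTwoNormSeparable (S : Set (Ultrapower A ω)) : Prop :=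
  ∃ D ⊆ S, D.Countable ∧ ∀ x ∈ S, ∀ ε : ℝ, 0 < ε → ∃ d ∈ D, limitTwoNorm (x - d) < ε

/-- `e` is the (necessarily unique) multiplicative identity of `B`; in particular `B` is unital. -/
def IsIdentity {B : Type*} [Mul B] (e : B) : Prop := ∀ x : B, e * x = x ∧ x * e = x

variable (A ω) in
/-- Uniform property `Γ`: for every `n ≥ 1` there are projections `p_1, …, p_n ∈ A^ω ∩ A'`
with sum `1_{A^ω}` such that `τ(a p_i) = τ(a) / n` for all `a ∈ A` and limit traces `τ`. -/
def HasUniformPropertyGamma : Prop :=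
  ∀ n : ℕ, 0 < n → ∃ p : Fin n → Ultrapower A ω,
    (∀ i, IsStarProjection (p i)) ∧
    (∀ i, p i ∈ Set.centralizer (Set.range (iota A ω))) ∧
    IsIdentity (∑ i, p i) ∧
    ∀ (a : A), ∀ τ ∈ LimitTraces A ω, ∀ i, τ (iota A ω a * p i) = 1 / (n : ℂ) * τ (iota A ω a)

end Ultrapower

/-! ### The ⋆-algebra `L^∞([0,1])` -/

section LInfty

open MeasureTheory

/-- `L^∞([0,1])`: essentially bounded complex functions on `[0,1]` modulo equality almost everywhere
for Lebesgue measure. -/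
abbrev LInfty : Type := Lp ℂ ∞ (volume.restrict (Set.Icc (0 : ℝ) 1))

instance : Mul LInfty where
  mul f g := MemLp.toLp (⇑f * ⇑g) ((Lp.memLp g).mul (Lp.memLp f))

instance : One LInfty where
  one := MemLp.toLp (fun _ => 1) (memLp_top_const 1)

lemma LInfty.coeFn_mul (f g : LInfty) :
    ⇑(f * g) =ᵐ[volume.restrict (Set.Icc (0 : ℝ) 1)] ⇑f * ⇑g := MemLp.coeFn_toLp _

lemma LInfty.coeFn_one :
    ⇑(1 : LInfty) =ᵐ[volume.restrict (Set.Icc (0 : ℝ) 1)] fun _ => 1 := MemLp.coeFn_toLp _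

instance : CommRing LInfty where
  __ := (inferInstance : AddCommGroup LInfty)
  left_distrib f g h := Lp.ext <| by
    filter_upwards [LInfty.coeFn_mul f (g + h), LInfty.coeFn_mul f g, LInfty.coeFn_mul f h,
      Lp.coeFn_add g h, Lp.coeFn_add (f * g) (f * h)] with x h1 h2 h3 h4 h5
    simp only [h1, h2, h3, h4, h5, Pi.mul_apply, Pi.add_apply, mul_add]
  right_distrib f g h := Lp.ext <| by
    filter_upwards [LInfty.coeFn_mul (f + g) h, LInfty.coeFn_mul f h, LInfty.coeFn_mul g h,
      Lp.coeFn_add f g, Lp.coeFn_add (f * h) (g * h)] with x h1 h2 h3 h4 h5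
    simp only [h1, h2, h3, h4, h5, Pi.mul_apply, Pi.add_apply, add_mul]
  zero_mul f := Lp.ext <| by
    filter_upwards [LInfty.coeFn_mul 0 f, Lp.coeFn_zero ℂ ∞ (volume.restrict (Set.Icc (0 : ℝ) 1))]
      with x h1 h2
    simp only [h1, h2, Pi.mul_apply, Pi.zero_apply, zero_mul]
  mul_zero f := Lp.ext <| by
    filter_upwards [LInfty.coeFn_mul f 0, Lp.coeFn_zero ℂ ∞ (volume.restrict (Set.Icc (0 : ℝ) 1))]
      with x h1 h2
    simp only [h1, h2, Pi.mul_apply, Pi.zero_apply, mul_zero]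
  mul_assoc f g h := Lp.ext <| by
    filter_upwards [LInfty.coeFn_mul (f * g) h, LInfty.coeFn_mul f g,
      LInfty.coeFn_mul f (g * h), LInfty.coeFn_mul g h] with x h1 h2 h3 h4
    simp only [h1, h2, h3, h4, Pi.mul_apply, mul_assoc]
  one_mul f := Lp.ext <| by
    filter_upwards [LInfty.coeFn_mul 1 f, LInfty.coeFn_one] with x h1 h2
    simp only [h1, h2, Pi.mul_apply, one_mul]
  mul_one f := Lp.ext <| by
    filter_upwards [LInfty.coeFn_mul f 1, LInfty.coeFn_one] with x h1 h2
    simp only [h1, h2, Pi.mul_apply, mul_one]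
  mul_comm f g := Lp.ext <| by
    filter_upwards [LInfty.coeFn_mul f g, LInfty.coeFn_mul g f] with x h1 h2
    simp only [h1, h2, Pi.mul_apply, mul_comm]

/-- Pointwise complex conjugation on `L^∞([0,1])`. -/
lemma LInfty.coeFn_star (f : LInfty) :
    ⇑(star f) =ᵐ[volume.restrict (Set.Icc (0 : ℝ) 1)] star ⇑f := Lp.coeFn_star f

end LInfty

end UniformGamma

end

/-!
# Equivalent forms of uniform property `Γ`

The substance is the passage from one central projection `p` that scales every limit trace by some
`lam ∈ (0, 1)` to a trace-independent central copy of `L^∞([0,1])`. It is carried out with elements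
of `A` rather than of `A^ω`, so that the algebra `A^ω` never has to be shown to be a C⋆-algebra or
to be complete.

A lift of `p` can be truncated to a sequence `h` of positive contractions
(`exists_isCentralScaling`); its members almost commute with any given finite set, are almost
idempotent, and almost scale all traces by `lam`. Given positive elements `q i` of `A` that behave
approximately like orthogonal central projections of trace `w i`, compression of a late member of
`h` cuts each `q i` into `q i * h * q i` and `q i - q i * h * q i`, whose weights are `lam * w i`
and `(1 - lam) * w i` (`HasApproxPartitions.prod_bool`). The starting point is a single positive
contraction on which all traces are almost `1`; it exists by compactness of `T(A)`
(`exists_re_apply_gt`), and it is an approximate unit for the uniform 2-norm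
(`uniformTwoNorm_mul_sub_le`). Iteration makes all weights small. As all the partitions
`(q i)` consist of positive elements with sum of norm at most one, their linear combinations are
bounded by their coefficients, however many terms there are (`norm_sum_smul_le`).

Now let the `k`-th partition of `A` be matched with a partition of `(0, 1]` into intervals whose
lengths are the weights, with errors tending to zero, and let it almost commute with the `k`-th
entries of the members, up to the `k`-th, of a sequence dense in `S`. The homomorphism sends `f` to
the class of `k ↦ ∑ i, (mean of f over the i-th interval) • q i` (`PartitionSequence.hom`).
Linearity is clear and the conditions on `S` follow termwise. For multiplicativity (`PartitionSequence.mk_seq_mul`),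
the 2-norm of a combination of the `q i` is controlled by the weighted `ℓ¹`-norm of its
coefficients, and the step functions of means converge to `f` almost everywhere by Lebesgue's
differentiation theorem, so that taking means is asymptotically multiplicative in `L¹`
(`tendsto_sum_norm_cellMean_mul_sub`). Successive partitions need not be compatible with each
other.

Conversely, applied to `S = ι(A)`, which is separable because `A` is, such a homomorphism sends the
indicator functions of `n` intervals of length `1 / n` to projections as in uniform property `Γ`.
-/

noncomputable section

namespace UniformGamma

/-! ### The uniform 2-norm -/

section TwoNorm

open Filter Topology
open scoped ComplexOrder

attribute [local instance] CStarAlgebra.spectralOrder CStarAlgebra.spectralOrderedRing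

variable {A : Type*} [NonUnitalCStarAlgebra A]

lemma uniformTwoNorm_zero : uniformTwoNorm (0 : A) = 0 :=
  le_antisymm (by simpa using uniformTwoNorm_smul_le (0 : ℂ) (0 : A)) (uniformTwoNorm_nonneg _)

lemma uniformTwoNorm_neg (a : A) : uniformTwoNorm (-a) = uniformTwoNorm a := by
  simp [uniformTwoNorm, twoNorm]

lemma uniformTwoNorm_sub_le (a b : A) :
    uniformTwoNorm (a - b) ≤ uniformTwoNorm a + uniformTwoNorm b := by
  simpa only [sub_eq_add_neg, uniformTwoNorm_neg] using uniformTwoNorm_add_le a (-b)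

lemma uniformTwoNorm_sum_le {ι : Type*} (s : Finset ι) (f : ι → A) :
    uniformTwoNorm (∑ i ∈ s, f i) ≤ ∑ i ∈ s, uniformTwoNorm (f i) := by
  classical
  induction s using Finset.induction_on with
  | empty => simp [uniformTwoNorm_zero]
  | insert i s hi ih =>
    rw [Finset.sum_insert hi, Finset.sum_insert hi]
    exact (uniformTwoNorm_add_le _ _).trans (by gcongr)

lemma norm_apply_le_uniformTwoNorm (τ : TraceSpace A) (a : A) :
    ‖(τ : WeakDual ℂ A) a‖ ≤ uniformTwoNorm a :=
  (norm_apply_le_twoNorm τ a).trans (twoNorm_le_uniform τ a)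

lemma uniformTwoNorm_mul_le_of_norm_le {a b : A} (ha : ‖a‖ ≤ 1) :
    uniformTwoNorm (a * b) ≤ uniformTwoNorm b :=
  (uniformTwoNorm_mul_le_left a b).trans
    (mul_le_of_le_one_left (uniformTwoNorm_nonneg b) ha)

lemma uniformTwoNorm_mul_le_of_norm_le' {a b : A} (hb : ‖b‖ ≤ 1) :
    uniformTwoNorm (a * b) ≤ uniformTwoNorm a :=
  (uniformTwoNorm_mul_le_right a b).trans
    (mul_le_of_le_one_left (uniformTwoNorm_nonneg a) hb)

lemma re_apply_mono (τ : TraceSpace A) {a b : A} (h : a ≤ b) :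
    ((τ : WeakDual ℂ A) a).re ≤ ((τ : WeakDual ℂ A) b).re :=
  (Complex.le_def.1 (OrderHomClass.mono (toPositive τ) h)).1

lemma apply_nonneg (τ : TraceSpace A) {a : A} (h : 0 ≤ a) : 0 ≤ (τ : WeakDual ℂ A) a := by
  have h' := OrderHomClass.mono (toPositive τ) h
  rw [map_zero] at h'
  exact h'

lemma twoNorm_sq (τ : TraceSpace A) (a : A) :
    twoNorm (τ : WeakDual ℂ A) a ^ 2 = ((τ : WeakDual ℂ A) (star a * a)).re :=
  Real.sq_sqrt (Complex.le_def.1 (τ.2.1 a)).1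

lemma twoNorm_le_of_star_mul_le (τ : TraceSpace A) {a b : A} (h : star a * a ≤ star b * b) :
    twoNorm (τ : WeakDual ℂ A) a ≤ twoNorm (τ : WeakDual ℂ A) b :=
  Real.sqrt_le_sqrt (re_apply_mono τ h)

lemma uniformTwoNorm_le_of_star_mul_le {a b : A} (h : star a * a ≤ star b * b) :
    uniformTwoNorm a ≤ uniformTwoNorm b :=
  uniformTwoNorm_le (uniformTwoNorm_nonneg b) fun τ =>
    (twoNorm_le_of_star_mul_le τ h).trans (twoNorm_le_uniform τ b)

lemma mul_self_le_of_norm_le_one {e : A} (he : 0 ≤ e) (he1 : ‖e‖ ≤ 1) : e * e ≤ e := by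
  have hs : IsSelfAdjoint e := .of_nonneg he
  have h : cfcₙ (fun x : ℝ => x * x) e ≤ cfcₙ (fun x : ℝ => x) e := by
    refine cfcₙ_mono fun x hx => ?_
    have h0 : 0 ≤ x := quasispectrum_nonneg_of_nonneg e he x hx
    have h1 : x ≤ 1 := (Real.le_norm_self x).trans
      ((NonUnitalIsometricContinuousFunctionalCalculus.norm_quasispectrum_le e hx).trans he1)
    nlinarith
  rwa [cfcₙ_mul (fun x : ℝ => x) (fun x : ℝ => x) e, cfcₙ_id' ℝ e] at h

/-- By compactness of `T(A)`, a Dini argument along the increasing approximate unit of `A` gives a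
positive contraction on which all tracial states are almost `1`. -/
lemma exists_re_apply_gt (hcpt : IsCompact (TraceSpace A)) {ε : ℝ} (hε : 0 < ε) :
    ∃ e : A, 0 ≤ e ∧ ‖e‖ ≤ 1 ∧ ∀ τ : TraceSpace A, 1 - ε < ((τ : WeakDual ℂ A) e).re := by
  set B : Set A := {x : A | 0 ≤ x} ∩ Metric.ball 0 1 with hB
  have h0 : (0 : A) ∈ B := ⟨le_refl (0 : A), by simp⟩
  let U : B → Set (TraceSpace A) := fun e => {τ | 1 - ε < ((τ : WeakDual ℂ A) (e : A)).re}
  have : Nonempty B := ⟨⟨0, h0⟩⟩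
  have hU : ∀ e, IsOpen (U e) := fun e =>
    isOpen_lt continuous_const (Complex.continuous_re.comp
      ((WeakDual.eval_continuous (e : A)).comp continuous_subtype_val))
  have hcover : Set.univ ⊆ ⋃ e, U e := by
    rintro ⟨τ, hτ⟩ -
    -- a cube, as `t` bounds `|τ(a)|` from below and also rescales `e` into the open unit ball
    obtain ⟨t, ht, ht1⟩ : ∃ t : ℝ, t < 1 ∧ 1 - ε < t ^ 3 ∧ 0 ≤ t := by
      have : ∀ᶠ t in 𝓝[<] (1 : ℝ), 1 - ε < t ^ 3 ∧ 0 ≤ t := by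
        refine nhdsWithin_le_nhds ?_
        refine Filter.Eventually.and ?_ (eventually_ge_nhds zero_lt_one)
        refine (continuous_pow 3).tendsto (1 : ℝ) |>.eventually (lt_mem_nhds ?_)
        simpa using hε
      obtain ⟨t, h1, h2⟩ := (this.and self_mem_nhdsWithin).exists
      exact ⟨t, h2, h1⟩
    obtain ⟨a, ha, hta⟩ : ∃ a : A, ‖a‖ ≤ 1 ∧ t < ‖τ a‖ := by
      by_contra! hc
      obtain ⟨a, ha, hta⟩ := (WeakDual.toStrongDual τ).exists_lt_apply_of_lt_opNorm
        (ht.trans_eq hτ.2.1.symm)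
      exact absurd hta (not_lt.2 (hc a ha.le))
    have hl := CStarAlgebra.increasingApproximateUnit A
    have := hl.neBot
    -- `|τ(ea)|² ≤ τ(e²) τ(a⋆a) ≤ τ(e)`, and `τ(ea) → τ(a)`
    have hlim : Tendsto (fun e => ‖τ (e * a)‖) (CStarAlgebra.approximateUnit A) (𝓝 ‖τ a‖) :=
      (((WeakDual.toStrongDual τ).continuous.tendsto a).comp (hl.tendsto_mul_right a)).norm
    obtain ⟨e, he, he0, he1⟩ :=
      ((hlim.eventually (lt_mem_nhds hta)).and (hl.eventually_nonneg.and hl.eventually_norm)).exists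
    have htn : ‖t • e‖ < 1 := by
      rw [norm_smul, Real.norm_of_nonneg ht1.2]
      exact (mul_le_of_le_one_right ht1.2 he1).trans_lt ht
    refine Set.mem_iUnion.2 ⟨⟨t • e, smul_nonneg ht1.2 he0, by simpa using htn⟩, ?_⟩
    have hs : star e * e ≤ e := by
      rw [(IsSelfAdjoint.of_nonneg he0).star_eq]
      exact mul_self_le_of_norm_le_one he0 he1
    have h1 := norm_apply_mul_le ⟨τ, hτ⟩ e a
    have h2 := (twoNorm_sq ⟨τ, hτ⟩ e).le.trans (re_apply_mono ⟨τ, hτ⟩ hs)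
    have h3 : twoNorm τ a ≤ 1 := (twoNorm_le_norm ⟨τ, hτ⟩ a).trans ha
    have h4 : t ≤ twoNorm τ e :=
      he.le.trans (h1.trans (mul_le_of_le_one_right (Real.sqrt_nonneg _) h3))
    have h5 : (τ (t • e)).re = t * (τ e).re := by
      rw [← Complex.coe_smul, map_smul, smul_eq_mul, Complex.re_ofReal_mul]
    change 1 - ε < (τ (t • e)).re
    rw [h5]
    refine ht1.1.trans_le ?_
    have h6 := mul_le_mul_of_nonneg_left ((pow_le_pow_left₀ ht1.2 h4 2).trans h2) ht1.2
    linarith [pow_succ' t 2]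
  have := isCompact_iff_compactSpace.1 hcpt
  obtain ⟨e, he⟩ := isCompact_univ.elim_directed_cover U hU hcover <| by
    intro x y
    obtain ⟨z, hz, hxz, hyz⟩ := CStarAlgebra.directedOn_nonneg_ball (x : A) x.2 (y : A) y.2
    exact ⟨⟨z, hz⟩, fun τ hτ => lt_of_lt_of_le hτ (re_apply_mono τ hxz),
      fun τ hτ => lt_of_lt_of_le hτ (re_apply_mono τ hyz)⟩
  exact ⟨e, e.2.1, (mem_ball_zero_iff.1 e.2.2).le, fun τ => he (Set.mem_univ τ)⟩

/-- A positive contraction on which all traces are almost `1` is almost a unit for the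
uniform 2-norm, uniformly on bounded sets. -/
lemma uniformTwoNorm_mul_sub_le {e : A} (he : 0 ≤ e) (he1 : ‖e‖ ≤ 1) {ε : ℝ}
    (h : ∀ τ : TraceSpace A, 1 - ε ≤ ((τ : WeakDual ℂ A) e).re) (a : A) :
    uniformTwoNorm (e * a - a) ≤ ‖a‖ * √ε := by
  refine uniformTwoNorm_le (by positivity) fun τ => ?_
  have hl := CStarAlgebra.increasingApproximateUnit A
  have := hl.neBot
  set l := CStarAlgebra.approximateUnit A
  have hcont : Continuous fun b : A => (τ : WeakDual ℂ A) b :=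
    (WeakDual.toStrongDual (τ : WeakDual ℂ A)).continuous
  have hcont2 : Continuous fun b : A => twoNorm (τ : WeakDual ℂ A) b :=
    Real.continuous_sqrt.comp (Complex.continuous_re.comp (hcont.comp (by fun_prop)))
  have h1 : Tendsto (fun f => twoNorm (τ : WeakDual ℂ A) ((e * f - f) * a)) l
      (𝓝 (twoNorm (τ : WeakDual ℂ A) (e * a - a))) := by
    refine (hcont2.tendsto _).comp ?_
    simp only [sub_mul, mul_assoc]
    exact ((hl.tendsto_mul_right a).const_mul e).sub (hl.tendsto_mul_right a)
  have hee : Tendsto (fun f => e * f * f) l (𝓝 e) := by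
    have h3 : Tendsto (fun f => e * f - e) l (𝓝 0) := by
      simpa using (hl.tendsto_mul_left e).sub_const e
    have h4 : Tendsto (fun f => (e * f - e) * f) l (𝓝 0) := by
      refine squeeze_zero_norm' ?_ (tendsto_zero_iff_norm_tendsto_zero.1 h3)
      filter_upwards [hl.eventually_norm] with f hf
      exact (norm_mul_le _ _).trans (mul_le_of_le_one_right (norm_nonneg _) hf)
    simpa [sub_mul] using h4.add (hl.tendsto_mul_left e)
  have h2 : Tendsto (fun f => ‖a‖ * √(1 - ((τ : WeakDual ℂ A) (e * f * f)).re)) l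
      (𝓝 (‖a‖ * √(1 - ((τ : WeakDual ℂ A) e).re))) := by
    refine Tendsto.const_mul _ ((Real.continuous_sqrt.tendsto _).comp (Tendsto.const_sub _ ?_))
    exact (Complex.continuous_re.tendsto _).comp ((hcont.tendsto _).comp hee)
  refine (le_of_tendsto_of_tendsto h1 h2 ?_).trans
    (mul_le_mul_of_nonneg_left (Real.sqrt_le_sqrt (by linarith [h τ])) (norm_nonneg a))
  filter_upwards [hl.eventually_nonneg, hl.eventually_norm] with f hf0 hf1
  have hfs := (IsSelfAdjoint.of_nonneg hf0).star_eq
  have hes := (IsSelfAdjoint.of_nonneg he).star_eq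
  have hr : twoNorm (τ : WeakDual ℂ A) ((e * f - f) * a)
      ≤ ‖a‖ * twoNorm (τ : WeakDual ℂ A) (e * f - f) := by
    rw [← twoNorm_star, star_mul, ← norm_star a, ← twoNorm_star τ (e * f - f)]
    exact twoNorm_mul_le_left _ _ _
  refine hr.trans (mul_le_mul_of_nonneg_left (Real.sqrt_le_sqrt ?_) (norm_nonneg a))
  -- `|(e - 1) f|² = f (e² - 2 e + 1) f ≤ f² - f e f`
  have hexp : star (e * f - f) * (e * f - f) ≤ f * f - f * e * f := by
    have h5 := star_left_conjugate_le_conjugate (mul_self_le_of_norm_le_one he he1) f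
    rw [hfs] at h5
    rw [star_sub, star_mul, hfs, hes]
    have h6 : (f * e - f) * (e * f - f) = f * (e * e) * f + (f * f - f * e * f - f * e * f) := by
      noncomm_ring
    calc _ ≤ f * e * f + (f * f - f * e * f - f * e * f) := h6.le.trans (add_le_add_left h5 _)
      _ = f * f - f * e * f := by abel
  refine (re_apply_mono τ hexp).trans ?_
  rw [map_sub, Complex.sub_re, mul_assoc f e f, τ.2.2.2 f (e * f)]
  have h8 : ((τ : WeakDual ℂ A) (f * f)).re ≤ 1 :=
    (Complex.re_le_norm _).trans ((norm_apply_le τ _).trans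
      ((norm_mul_le f f).trans (mul_le_one₀ hf1 (norm_nonneg f) hf1)))
  linarith

end TwoNorm

/-! ### Lifting from the ultrapower -/

section Lifting

open Filter Topology

attribute [local instance] CStarAlgebra.spectralOrder CStarAlgebra.spectralOrderedRing

variable {A : Type*} [NonUnitalCStarAlgebra A] {ω : Ultrafilter ℕ}

/-- Truncating the spectrum of a self-adjoint `c` to `[0,1]` moves `c` by at most
`‖c² - c‖_{2,T(A)}`, since the distance of a real `t` to `[0,1]` is at most `|t² - t|`. -/
lemma exists_positive_contraction_near {c : A} (hc : IsSelfAdjoint c) :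
    ∃ h : A, 0 ≤ h ∧ ‖h‖ ≤ 1 ∧ uniformTwoNorm (h - c) ≤ uniformTwoNorm (c * c - c) := by
  let f : ℝ → ℝ := fun t => max 0 (min 1 t)
  have hf : Continuous f := by fun_prop
  have hf0 : f 0 = 0 := by simp [f]
  have hff : ∀ t, 0 ≤ f t ∧ f t ≤ 1 := fun t =>
    ⟨le_max_left _ _, max_le zero_le_one (min_le_left _ _)⟩
  refine ⟨cfcₙ f c, cfcₙ_nonneg fun x _ => (hff x).1, norm_cfcₙ_le fun x _ => ?_, ?_⟩
  · rw [Real.norm_of_nonneg (hff x).1]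
    exact (hff x).2
  · have h1 : cfcₙ f c - c = cfcₙ (fun t => f t - t) c := by
      rw [cfcₙ_sub f (fun t => t) c, cfcₙ_id' ℝ c]
    have h2 : c * c - c = cfcₙ (fun t : ℝ => t * t - t) c := by
      rw [cfcₙ_sub (fun t => t * t) (fun t => t) c, cfcₙ_mul (fun t : ℝ => t) (fun t => t) c,
        cfcₙ_id' ℝ c]
    rw [h1, h2]
    refine uniformTwoNorm_le_of_star_mul_le ?_
    rw [(cfcₙ_predicate (fun t => f t - t) c).star_eq,
      (cfcₙ_predicate (fun t : ℝ => t * t - t) c).star_eq,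
      ← cfcₙ_mul (fun t => f t - t) (fun t => f t - t) c,
      ← cfcₙ_mul (fun t : ℝ => t * t - t) (fun t => t * t - t) c]
    refine cfcₙ_mono fun t _ => ?_
    rw [← sq, ← sq]
    refine sq_le_sq.2 ?_
    simp only [f]
    rcases le_total t 0 with h | h
    · rw [min_eq_right (h.trans zero_le_one), max_eq_left h]
      rw [abs_of_nonneg (by linarith), abs_of_nonneg (by nlinarith)]
      nlinarith
    · rcases le_total t 1 with h' | h'
      · rw [min_eq_right h', max_eq_right h]
        simp
      · rw [min_eq_left h', max_eq_right zero_le_one, abs_of_nonpos (by linarith),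
          abs_of_nonneg (by nlinarith)]
        nlinarith

/-- The bounded sequence given by a function `ℕ → A` with a bound on its values. -/
def boundedSeq (x : ℕ → A) (C : ℝ) (hx : ∀ n, ‖x n‖ ≤ C) : BoundedSeq A :=
  ⟨x, memℓp_infty ⟨C, by rintro _ ⟨n, rfl⟩; exact hx n⟩⟩

lemma tendsto_of_mk_eq_mk {a b : BoundedSeq A} (h : mk A ω a = mk A ω b) :
    Tendsto (fun n => uniformTwoNorm (a n - b n)) ω (𝓝 0) := by
  simpa only [mem_traceNull, lp.coeFn_sub, Pi.sub_apply] using mk_eq_mk.1 h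

lemma mk_eq_mk_of_tendsto {a b : BoundedSeq A}
    (h : Tendsto (fun n => uniformTwoNorm (a n - b n)) ω (𝓝 0)) : mk A ω a = mk A ω b := by
  refine mk_eq_mk.2 ?_
  simpa only [mem_traceNull, lp.coeFn_sub, Pi.sub_apply] using h

/-- Projections of `A^ω` lift to sequences of positive contractions. -/
lemma exists_positive_contraction_lift {p : Ultrapower A ω} (hp : IsStarProjection p) :
    ∃ h : BoundedSeq A, (∀ n, 0 ≤ h n) ∧ (∀ n, ‖h n‖ ≤ 1) ∧ mk A ω h = p := by
  obtain ⟨b, rfl⟩ := mk_surjective p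
  set c : BoundedSeq A := (2⁻¹ : ℂ) • (b + star b) with hc
  have hmc : mk A ω c = mk A ω b := by
    rw [hc, map_smul, map_add, mk_star, hp.isSelfAdjoint.star_eq, ← two_smul ℂ, smul_smul]
    norm_num
  have hcs : ∀ n, IsSelfAdjoint (c n) := fun n => by
    have hcn : c n = (2⁻¹ : ℂ) • (b n + star (b n)) := rfl
    rw [isSelfAdjoint_iff, hcn]
    simp [add_comm]
  choose h h0 h1 hh using fun n => exists_positive_contraction_near (hcs n)
  refine ⟨boundedSeq h 1 h1, h0, h1, hmc ▸ mk_eq_mk_of_tendsto ?_⟩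
  have hcc : mk A ω (c * c) = mk A ω c := by
    rw [mk_mul, hmc]
    exact hp.isIdempotentElem
  have hlim := tendsto_of_mk_eq_mk hcc
  exact squeeze_zero (fun n => uniformTwoNorm_nonneg _) hh hlim

/-- A sequence on which all limit traces vanish is uniformly small on traces along `ω`. -/
lemma eventually_forall_norm_apply_le {x : BoundedSeq A}
    (hx : ∀ τ ∈ LimitTraces A ω, τ (mk A ω x) = 0) {ε : ℝ} (hε : 0 < ε) :
    ∀ᶠ n in (ω : Filter ℕ), ∀ τ : TraceSpace A, ‖(τ : WeakDual ℂ A) (x n)‖ ≤ ε := by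
  by_contra hcon
  rw [← Ultrafilter.eventually_not] at hcon
  have hne : Nonempty (TraceSpace A) := by
    obtain ⟨n, hn⟩ := hcon.exists
    push Not at hn
    exact ⟨hn.choose⟩
  have : ∀ n, ∃ τ : TraceSpace A, (¬ ∀ τ : TraceSpace A, ‖(τ : WeakDual ℂ A) (x n)‖ ≤ ε) →
      ε < ‖(τ : WeakDual ℂ A) (x n)‖ := fun n => by
    by_cases h : ∀ τ : TraceSpace A, ‖(τ : WeakDual ℂ A) (x n)‖ ≤ ε
    · exact ⟨hne.some, fun h' => absurd h h'⟩
    · push Not at h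
      exact ⟨h.choose, fun _ => h.choose_spec⟩
  choose τ hτ using this
  have hlim := (tendsto_limitTrace τ x (ω := ω)).norm
  rw [hx _ ⟨τ, rfl⟩, norm_zero] at hlim
  exact absurd (ge_of_tendsto hlim (hcon.mono fun n hn => (hτ n hn).le)) (not_le.2 hε)

/-- A family of sequences of positive contractions of `A`, asymptotically central projections for
the uniform 2-norm, on which every tracial state is asymptotically scaled by `lam`. -/
def IsCentralScaling (ω : Ultrafilter ℕ) (lam : ℝ) (h : ℕ → A) : Prop :=
  (∀ n, 0 ≤ h n) ∧ (∀ n, ‖h n‖ ≤ 1) ∧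
  Tendsto (fun n => uniformTwoNorm (h n * h n - h n)) ω (𝓝 0) ∧
  (∀ a, Tendsto (fun n => uniformTwoNorm (h n * a - a * h n)) ω (𝓝 0)) ∧
  ∀ a, ∀ ε : ℝ, 0 < ε → ∀ᶠ n in (ω : Filter ℕ), ∀ τ : TraceSpace A,
    ‖(τ : WeakDual ℂ A) (a * h n) - lam * (τ : WeakDual ℂ A) a‖ ≤ ε

lemma exists_isCentralScaling {lam : ℝ} {p : Ultrapower A ω} (hp : IsStarProjection p)
    (hpA : p ∈ Set.centralizer (Set.range (iota A ω)))
    (hpt : ∀ (a : A), ∀ τ ∈ LimitTraces A ω,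
      τ (iota A ω a * p) = (lam : ℂ) * τ (iota A ω a)) :
    ∃ h : ℕ → A, IsCentralScaling ω lam h := by
  obtain ⟨h, h0, h1, rfl⟩ := exists_positive_contraction_lift hp
  refine ⟨h, h0, h1, ?_, fun a => ?_, fun a ε hε => ?_⟩
  · exact tendsto_of_mk_eq_mk (a := h * h) (b := h) (by rw [mk_mul]; exact hp.isIdempotentElem)
  · refine tendsto_of_mk_eq_mk (a := h * constSeq a) (b := constSeq a * h) ?_
    rw [mk_mul, mk_mul]
    exact (hpA _ ⟨a, rfl⟩).symm
  · have := eventually_forall_norm_apply_le (ω := ω)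
      (x := constSeq a * h - (lam : ℂ) • constSeq a) (fun τ hτ => ?_) hε
    · refine this.mono fun n hn τ => ?_
      have h2 := hn τ
      have h3 : (constSeq a * h - (lam : ℂ) • constSeq a : BoundedSeq A) n
          = a * h n - (lam : ℂ) • a := rfl
      rwa [h3, map_sub, map_smul, smul_eq_mul] at h2
    · rw [map_sub, map_smul, map_sub, map_smul, mk_mul, smul_eq_mul]
      exact sub_eq_zero.2 (hpt a τ hτ)

end Lifting

/-! ### Approximate partitions of unity with prescribed weights -/

section Partitions

open Filter Topology

attribute [local instance] CStarAlgebra.spectralOrder CStarAlgebra.spectralOrderedRing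

variable {A : Type*} [NonUnitalCStarAlgebra A] {ω : Ultrafilter ℕ}

lemma norm_mul_le_one {a b : A} (ha : ‖a‖ ≤ 1) (hb : ‖b‖ ≤ 1) : ‖a * b‖ ≤ 1 :=
  (norm_mul_le a b).trans (mul_le_one₀ ha (norm_nonneg b) hb)

section Compression

variable {q h a : A} {δ : ℝ}

lemma uniformTwoNorm_compression_idempotent (hq : ‖q‖ ≤ 1) (hh : ‖h‖ ≤ 1)
    (hqq : uniformTwoNorm (q * q - q) ≤ δ)
    (hhh : uniformTwoNorm (h * h - h) ≤ δ) (hhq : uniformTwoNorm (h * q - q * h) ≤ δ) :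
    uniformTwoNorm ((q * h * q) * (q * h * q) - q * h * q) ≤ 5 * δ := by
  have e : (q * h * q) * (q * h * q) - q * h * q
      = q * h * ((q * q - q) * (h * q)) + q * ((h * q - q * h) * (h * q))
        + q * q * ((h * h - h) * q) - q * ((h * q - q * h) * q) + q * h * (q * q - q) := by
    noncomm_ring
  have hqh := norm_mul_le_one hq hh
  have hhq' := norm_mul_le_one hh hq
  have hqq' := norm_mul_le_one hq hq
  have b1 := (uniformTwoNorm_mul_le_of_norm_le (b := (q * q - q) * (h * q)) hqh).trans
    ((uniformTwoNorm_mul_le_of_norm_le' hhq').trans hqq)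
  have b2 := (uniformTwoNorm_mul_le_of_norm_le (b := (h * q - q * h) * (h * q)) hq).trans
    ((uniformTwoNorm_mul_le_of_norm_le' hhq').trans hhq)
  have b3 := (uniformTwoNorm_mul_le_of_norm_le (b := (h * h - h) * q) hqq').trans
    ((uniformTwoNorm_mul_le_of_norm_le' hq).trans hhh)
  have b4 := (uniformTwoNorm_mul_le_of_norm_le (b := (h * q - q * h) * q) hq).trans
    ((uniformTwoNorm_mul_le_of_norm_le' hq).trans hhq)
  have b5 := (uniformTwoNorm_mul_le_of_norm_le (b := q * q - q) hqh).trans hqq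
  rw [e]
  refine (uniformTwoNorm_add_le _ _).trans ?_
  have t1 := uniformTwoNorm_sub_le (q * h * ((q * q - q) * (h * q))
    + q * ((h * q - q * h) * (h * q)) + q * q * ((h * h - h) * q)) (q * ((h * q - q * h) * q))
  have t2 := uniformTwoNorm_add_le (q * h * ((q * q - q) * (h * q))
    + q * ((h * q - q * h) * (h * q))) (q * q * ((h * h - h) * q))
  have t3 := uniformTwoNorm_add_le (q * h * ((q * q - q) * (h * q)))
    (q * ((h * q - q * h) * (h * q)))
  linarith

lemma uniformTwoNorm_compression_mul_sub (hq : ‖q‖ ≤ 1) (hh : ‖h‖ ≤ 1)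
    (hqq : uniformTwoNorm (q * q - q) ≤ δ)
    (hhh : uniformTwoNorm (h * h - h) ≤ δ) (hhq : uniformTwoNorm (h * q - q * h) ≤ δ) :
    uniformTwoNorm ((q * h * q) * (q - q * h * q)) ≤ 6 * δ := by
  have e : (q * h * q) * (q - q * h * q)
      = q * h * (q * q - q) - ((q * h * q) * (q * h * q) - q * h * q) := by noncomm_ring
  rw [e]
  have b1 := (uniformTwoNorm_mul_le_of_norm_le (b := q * q - q) (norm_mul_le_one hq hh)).trans hqq
  have b2 := uniformTwoNorm_compression_idempotent hq hh hqq hhh hhq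
  linarith [uniformTwoNorm_sub_le (q * h * (q * q - q))
    ((q * h * q) * (q * h * q) - q * h * q)]

lemma uniformTwoNorm_sub_mul_compression (hq : ‖q‖ ≤ 1) (hh : ‖h‖ ≤ 1)
    (hqq : uniformTwoNorm (q * q - q) ≤ δ)
    (hhh : uniformTwoNorm (h * h - h) ≤ δ) (hhq : uniformTwoNorm (h * q - q * h) ≤ δ) :
    uniformTwoNorm ((q - q * h * q) * (q * h * q)) ≤ 6 * δ := by
  have e : (q - q * h * q) * (q * h * q)
      = (q * q - q) * (h * q) - ((q * h * q) * (q * h * q) - q * h * q) := by noncomm_ring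
  rw [e]
  have b1 := (uniformTwoNorm_mul_le_of_norm_le' (a := q * q - q) (norm_mul_le_one hh hq)).trans hqq
  have b2 := uniformTwoNorm_compression_idempotent hq hh hqq hhh hhq
  linarith [uniformTwoNorm_sub_le ((q * q - q) * (h * q))
    ((q * h * q) * (q * h * q) - q * h * q)]

lemma uniformTwoNorm_sub_compression_idempotent (hq : ‖q‖ ≤ 1) (hh : ‖h‖ ≤ 1)
    (hqq : uniformTwoNorm (q * q - q) ≤ δ)
    (hhh : uniformTwoNorm (h * h - h) ≤ δ) (hhq : uniformTwoNorm (h * q - q * h) ≤ δ) :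
    uniformTwoNorm ((q - q * h * q) * (q - q * h * q) - (q - q * h * q)) ≤ 8 * δ := by
  have e : (q - q * h * q) * (q - q * h * q) - (q - q * h * q)
      = (q * q - q) - (q * q - q) * (h * q) - (q * h * q) * (q - q * h * q) := by noncomm_ring
  rw [e]
  have b1 := (uniformTwoNorm_mul_le_of_norm_le' (a := q * q - q) (norm_mul_le_one hh hq)).trans hqq
  have b2 := uniformTwoNorm_compression_mul_sub hq hh hqq hhh hhq
  linarith [uniformTwoNorm_sub_le ((q * q - q) - (q * q - q) * (h * q))
    ((q * h * q) * (q - q * h * q)), uniformTwoNorm_sub_le (q * q - q) ((q * q - q) * (h * q))]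

lemma uniformTwoNorm_compression_commutator (hq : ‖q‖ ≤ 1) (hh : ‖h‖ ≤ 1)
    (hqa : uniformTwoNorm (q * a - a * q) ≤ δ)
    (hha : uniformTwoNorm (h * a - a * h) ≤ δ) :
    uniformTwoNorm (q * h * q * a - a * (q * h * q)) ≤ 3 * δ := by
  have e : q * h * q * a - a * (q * h * q) = q * h * (q * a - a * q)
      + q * ((h * a - a * h) * q) + (q * a - a * q) * (h * q) := by noncomm_ring
  rw [e]
  have b1 := (uniformTwoNorm_mul_le_of_norm_le (b := q * a - a * q)
    (norm_mul_le_one hq hh)).trans hqa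
  have b2 := (uniformTwoNorm_mul_le_of_norm_le (b := (h * a - a * h) * q) hq).trans
    ((uniformTwoNorm_mul_le_of_norm_le' hq).trans hha)
  have b3 := (uniformTwoNorm_mul_le_of_norm_le' (a := q * a - a * q)
    (norm_mul_le_one hh hq)).trans hqa
  linarith [uniformTwoNorm_add_le (q * h * (q * a - a * q) + q * ((h * a - a * h) * q))
    ((q * a - a * q) * (h * q)), uniformTwoNorm_add_le (q * h * (q * a - a * q))
    (q * ((h * a - a * h) * q))]

lemma uniformTwoNorm_sub_compression_commutator (hq : ‖q‖ ≤ 1) (hh : ‖h‖ ≤ 1)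
    (hqa : uniformTwoNorm (q * a - a * q) ≤ δ)
    (hha : uniformTwoNorm (h * a - a * h) ≤ δ) :
    uniformTwoNorm ((q - q * h * q) * a - a * (q - q * h * q)) ≤ 4 * δ := by
  have e : (q - q * h * q) * a - a * (q - q * h * q)
      = (q * a - a * q) - (q * h * q * a - a * (q * h * q)) := by noncomm_ring
  rw [e]
  linarith [uniformTwoNorm_sub_le (q * a - a * q) (q * h * q * a - a * (q * h * q)),
    uniformTwoNorm_compression_commutator hq hh hqa hha]

/-- The two pieces of `q` are almost orthogonal to the two pieces of `r` when `q` is almost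
orthogonal to `r`: the former have `q` as a right factor, the latter `r` as a left factor. -/
lemma uniformTwoNorm_mul_le_of_compressions {r y z : A} (hq : ‖q‖ ≤ 1) (hr : ‖r‖ ≤ 1)
    (hh : ‖h‖ ≤ 1) (hqr : uniformTwoNorm (q * r) ≤ δ)
    (hy : y = q * h * q ∨ y = q - q * h * q) (hz : z = r * h * r ∨ z = r - r * h * r) :
    uniformTwoNorm (y * z) ≤ 4 * δ := by
  have hδ : 0 ≤ δ := (uniformTwoNorm_nonneg _).trans hqr
  have b1 := (uniformTwoNorm_mul_le_of_norm_le (b := q * r) (norm_mul_le_one hq hh)).trans hqr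
  have hyr : uniformTwoNorm (y * r) ≤ 2 * δ := by
    rcases hy with rfl | rfl
    · rw [mul_assoc]
      linarith
    · rw [sub_mul, mul_assoc (q * h)]
      linarith [uniformTwoNorm_sub_le (q * r) (q * h * (q * r))]
  have b2 := (uniformTwoNorm_mul_le_of_norm_le' (a := y * r) (norm_mul_le_one hh hr)).trans hyr
  rcases hz with rfl | rfl
  · have e : y * (r * h * r) = y * r * (h * r) := by noncomm_ring
    rw [e]
    linarith
  · have e : y * (r - r * h * r) = y * r - y * r * (h * r) := by noncomm_ring
    rw [e]
    linarith [uniformTwoNorm_sub_le (y * r) (y * r * (h * r))]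

end Compression

/-- A finite family of positive elements of `A` with sum of norm at most one that satisfies, up to
`ε` in the uniform 2-norm and uniformly on `T(A)`, the relations of mutually orthogonal projections
which commute with `F` and on which every trace `τ` and every functional `τ(a ·)`, `a ∈ F`, take
the values `w i` and `w i * τ(a)`. -/
structure IsApproxPartition {ι : Type*} [Fintype ι] (w : ι → ℝ) (F : Finset A) (ε : ℝ)
    (q : ι → A) : Prop where
  nonneg : ∀ i, 0 ≤ q i
  norm_sum_le_one : ‖∑ i, q i‖ ≤ 1
  idempotent : ∀ i, uniformTwoNorm (q i * q i - q i) ≤ ε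
  orthogonal : ∀ i j, i ≠ j → uniformTwoNorm (q i * q j) ≤ ε
  commutator : ∀ a ∈ F, ∀ i, uniformTwoNorm (q i * a - a * q i) ≤ ε
  trace_mul : ∀ a ∈ F, ∀ i, ∀ τ : TraceSpace A,
    ‖(τ : WeakDual ℂ A) (a * q i) - w i * (τ : WeakDual ℂ A) a‖ ≤ ε
  trace : ∀ i, ∀ τ : TraceSpace A, ‖(τ : WeakDual ℂ A) (q i) - w i‖ ≤ ε

lemma IsApproxPartition.norm_le {ι : Type*} [Fintype ι] {w : ι → ℝ} {F : Finset A} {ε : ℝ}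
    {q : ι → A} (h : IsApproxPartition w F ε q) (i : ι) : ‖q i‖ ≤ 1 :=
  (CStarAlgebra.norm_le_norm_of_nonneg_of_le (h.nonneg i)
    (Finset.single_le_sum (fun j _ => h.nonneg j) (Finset.mem_univ i))).trans h.norm_sum_le_one

variable (A) in
/-- `A` admits arbitrarily good, arbitrarily central approximate partitions with weights `w`. -/
def HasApproxPartitions {ι : Type*} [Fintype ι] (w : ι → ℝ) : Prop :=
  ∀ (F : Finset A) (ε : ℝ), 0 < ε → ∃ q : ι → A, IsApproxPartition w F ε q

lemma hasApproxPartitions_unit (hcpt : IsCompact (TraceSpace A)) :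
    HasApproxPartitions A (fun _ : Unit => (1 : ℝ)) := by
  intro F ε hε
  obtain ⟨C, hC1, hC⟩ : ∃ C : ℝ, 1 ≤ C ∧ ∀ a ∈ F, ‖a‖ ≤ C := by
    refine ⟨1 + ∑ a ∈ F, ‖a‖, le_add_of_nonneg_right (by positivity), fun a ha => ?_⟩
    linarith [Finset.single_le_sum (f := fun a => ‖a‖) (fun b _ => norm_nonneg b) ha]
  obtain ⟨η, hη, hη1⟩ : ∃ η : ℝ, 0 < η ∧ C * (2 * η) ≤ ε :=
    ⟨ε / (2 * C), by positivity, by field_simp; rfl⟩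
  have hηε : 2 * η ≤ ε := by nlinarith
  obtain ⟨e, he0, he1, he⟩ := exists_re_apply_gt hcpt (ε := min η (η ^ 2)) (by positivity)
  have hunit : ∀ a : A, ‖a‖ ≤ C → uniformTwoNorm (e * a - a) ≤ C * η := fun a ha => by
    refine (uniformTwoNorm_mul_sub_le he0 he1 (ε := η ^ 2) (fun τ => ?_) a).trans ?_
    · linarith [he τ, min_le_right η (η ^ 2)]
    · rw [Real.sqrt_sq hη.le]
      gcongr
  have hunit' : ∀ a : A, ‖a‖ ≤ C → uniformTwoNorm (a * e - a) ≤ C * η := fun a ha => by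
    have := hunit (star a) (by rwa [norm_star])
    rwa [← uniformTwoNorm_star, star_sub, star_mul, star_star,
      (IsSelfAdjoint.of_nonneg he0).star_eq] at this
  refine ⟨fun _ => e, ⟨fun _ => he0, by simpa using he1, fun _ => ?_,
    fun i j hij => absurd (Subsingleton.elim i j) hij, fun a ha _ => ?_, fun a ha _ τ => ?_,
    fun _ τ => ?_⟩⟩
  · linarith [hunit e (he1.trans hC1)]
  · have h : e * a - a * e = (e * a - a) - (a * e - a) := by abel
    rw [h]
    linarith [uniformTwoNorm_sub_le (e * a - a) (a * e - a), hunit a (hC a ha),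
      hunit' a (hC a ha)]
  · rw [Complex.ofReal_one, one_mul, ← map_sub]
    linarith [norm_apply_le_uniformTwoNorm τ (a * e - a), hunit' a (hC a ha)]
  · have h0 := Complex.le_def.1 (apply_nonneg τ he0)
    have h1 := (Complex.re_le_norm _).trans ((norm_apply_le τ e).trans he1)
    have h2 : (τ : WeakDual ℂ A) e = (((τ : WeakDual ℂ A) e).re : ℂ) :=
      Complex.ext rfl h0.2.symm
    rw [h2, ← Complex.ofReal_sub, Complex.norm_real, Real.norm_eq_abs, abs_le]
    constructor <;> linarith [he τ, min_le_left η (η ^ 2)]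

/-- Compressing a central scaling sequence by the members `q i` of an approximate partition splits
each of them as `q i * h * q i + (q i - q i * h * q i)`, hence each weight in the ratio
`lam : 1 - lam`. -/
lemma HasApproxPartitions.prod_bool {lam : ℝ} (hl0 : 0 < lam) (hl1 : lam < 1) {h : ℕ → A}
    (hh : IsCentralScaling ω lam h) {ι : Type*} [Fintype ι] {w : ι → ℝ}
    (hw : HasApproxPartitions A w) :
    HasApproxPartitions A
      (fun i : ι × Bool => (if i.2 then lam else 1 - lam) * w i.1) := by
  classical
  intro F ε hε
  obtain ⟨C, hC1, hC⟩ : ∃ C : ℝ, 1 ≤ C ∧ ∀ a ∈ F, ‖a‖ ≤ C := by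
    refine ⟨1 + ∑ a ∈ F, ‖a‖, le_add_of_nonneg_right (by positivity), fun a ha => ?_⟩
    linarith [Finset.single_le_sum (f := fun a => ‖a‖) (fun b _ => norm_nonneg b) ha]
  -- `8` is the largest constant in the estimates for compressions
  obtain ⟨δ, hδ, hδε⟩ : ∃ δ : ℝ, 0 < δ ∧ C * (8 * δ) ≤ ε :=
    ⟨ε / (8 * C), by positivity, by field_simp; rfl⟩
  have hδ8 : 8 * δ ≤ ε := by nlinarith
  obtain ⟨q, hq⟩ := hw F δ hδ
  obtain ⟨h0, h1, hidem, hcomm, htr⟩ := hh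
  have hsmall : ∀ {x : ℕ → A}, Tendsto (fun n => uniformTwoNorm (x n)) ω (𝓝 0) →
      ∀ᶠ n in (ω : Filter ℕ), uniformTwoNorm (x n) ≤ δ :=
    fun hx => hx.eventually (ge_mem_nhds hδ)
  obtain ⟨m, hm1, hm2, hm3, hm4, hm5⟩ := ((hsmall hidem).and
    (((Finset.eventually_all F).2 fun a _ => hsmall (hcomm a)).and
    ((eventually_all.2 fun i => hsmall (hcomm (q i))).and
    (((Finset.eventually_all F).2 fun a _ => eventually_all.2 fun i =>
      htr (q i * a * q i) δ hδ).and
    (eventually_all.2 fun i => htr (q i * q i) δ hδ))))).exists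
  have hpos : ∀ i, q i * h m * q i ≤ q i := fun i => by
    have hs := (IsSelfAdjoint.of_nonneg (hq.nonneg i)).star_eq
    have h2 := CStarAlgebra.star_left_conjugate_le_norm_smul (a := q i)
      (IsSelfAdjoint.of_nonneg (h0 m))
    rw [hs] at h2
    have hqq : 0 ≤ q i * q i := by
      have := star_mul_self_nonneg (q i)
      rwa [hs] at this
    refine h2.trans (((smul_le_smul_of_nonneg_right (h1 m) hqq).trans_eq (one_smul ℝ _)).trans ?_)
    exact mul_self_le_of_norm_le_one (hq.nonneg i) (hq.norm_le i)
  have htr1 : ∀ a ∈ F, ∀ i, ∀ τ : TraceSpace A,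
      ‖(τ : WeakDual ℂ A) (a * (q i * h m * q i)) - (lam * w i : ℝ) * (τ : WeakDual ℂ A) a‖
        ≤ 2 * δ + C * δ := fun a ha i τ => by
    have e1 : (τ : WeakDual ℂ A) (a * (q i * h m * q i))
        = (τ : WeakDual ℂ A) (q i * a * q i * h m) := by
      rw [τ.2.2.2 a, mul_assoc (q i * h m), τ.2.2.2 (q i * h m), ← mul_assoc]
    have e2 : (τ : WeakDual ℂ A) (q i * a * q i)
        = (τ : WeakDual ℂ A) (a * (q i * q i - q i)) + (τ : WeakDual ℂ A) (a * q i) := by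
      rw [mul_assoc, τ.2.2.2 (q i), ← map_add]
      congr 1
      noncomm_ring
    have b1 := hm4 a ha i τ
    have b2 := hq.trace_mul a ha i τ
    have b3 : ‖(τ : WeakDual ℂ A) (a * (q i * q i - q i))‖ ≤ C * δ :=
      (norm_apply_le_uniformTwoNorm τ _).trans ((uniformTwoNorm_mul_le_left _ _).trans
        (mul_le_mul (hC a ha) (hq.idempotent i) (uniformTwoNorm_nonneg _) (by linarith)))
    have e3 : (τ : WeakDual ℂ A) (a * (q i * h m * q i)) - (lam * w i : ℝ) * (τ : WeakDual ℂ A) a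
        = ((τ : WeakDual ℂ A) (q i * a * q i * h m) - lam * (τ : WeakDual ℂ A) (q i * a * q i))
          + lam * ((τ : WeakDual ℂ A) (a * (q i * q i - q i))
            + ((τ : WeakDual ℂ A) (a * q i) - w i * (τ : WeakDual ℂ A) a)) := by
      rw [e1, e2]
      push_cast
      ring
    rw [e3]
    refine (norm_add_le _ _).trans ?_
    rw [norm_mul, Complex.norm_real, Real.norm_of_nonneg hl0.le]
    have b4 := (norm_add_le ((τ : WeakDual ℂ A) (a * (q i * q i - q i)))
      ((τ : WeakDual ℂ A) (a * q i) - w i * (τ : WeakDual ℂ A) a)).trans (add_le_add b3 b2)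
    have b5 := mul_le_of_le_one_left (norm_nonneg ((τ : WeakDual ℂ A) (a * (q i * q i - q i))
      + ((τ : WeakDual ℂ A) (a * q i) - w i * (τ : WeakDual ℂ A) a))) hl1.le
    linarith
  have htr2 : ∀ i, ∀ τ : TraceSpace A,
      ‖(τ : WeakDual ℂ A) (q i * h m * q i) - (lam * w i : ℝ)‖ ≤ 3 * δ := fun i τ => by
    have e1 : (τ : WeakDual ℂ A) (q i * h m * q i) = (τ : WeakDual ℂ A) (q i * q i * h m) := by
      rw [τ.2.2.2, ← mul_assoc]
    have e3 : (τ : WeakDual ℂ A) (q i * h m * q i) - (lam * w i : ℝ)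
        = ((τ : WeakDual ℂ A) (q i * q i * h m) - lam * (τ : WeakDual ℂ A) (q i * q i))
          + lam * ((τ : WeakDual ℂ A) (q i * q i - q i)
            + ((τ : WeakDual ℂ A) (q i) - w i)) := by
      rw [e1, map_sub]
      push_cast
      ring
    rw [e3]
    refine (norm_add_le _ _).trans ?_
    rw [norm_mul, Complex.norm_real, Real.norm_of_nonneg hl0.le]
    have b3 := (norm_apply_le_uniformTwoNorm τ _).trans (hq.idempotent i)
    have b4 := (norm_add_le ((τ : WeakDual ℂ A) (q i * q i - q i))
      ((τ : WeakDual ℂ A) (q i) - w i)).trans (add_le_add b3 (hq.trace i τ))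
    have b5 := mul_le_of_le_one_left (norm_nonneg ((τ : WeakDual ℂ A) (q i * q i - q i)
      + ((τ : WeakDual ℂ A) (q i) - w i))) hl1.le
    linarith [hm5 i τ]
  have hCδ : δ ≤ C * δ := le_mul_of_one_le_left hδ.le hC1
  refine ⟨fun i => if i.2 then q i.1 * h m * q i.1 else q i.1 - q i.1 * h m * q i.1,
    ⟨?_, ?_, ?_, ?_, ?_, ?_, ?_⟩⟩
  · rintro ⟨i, _ | _⟩
    · simpa using hpos i
    · exact conjugate_nonneg_of_nonneg (h0 m) (hq.nonneg i)
  · simpa [Fintype.sum_prod_type] using hq.norm_sum_le_one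
  · rintro ⟨i, _ | _⟩
    · exact (uniformTwoNorm_sub_compression_idempotent (hq.norm_le i) (h1 m) (hq.idempotent i) hm1
        (hm3 i)).trans hδ8
    · exact (uniformTwoNorm_compression_idempotent (hq.norm_le i) (h1 m) (hq.idempotent i) hm1
        (hm3 i)).trans (by linarith)
  · rintro ⟨i, b⟩ ⟨j, c⟩ hij
    rcases eq_or_ne i j with rfl | hne
    · rcases b with _ | _ <;> rcases c with _ | _
      · exact absurd rfl hij
      · exact (uniformTwoNorm_sub_mul_compression (hq.norm_le i) (h1 m) (hq.idempotent i) hm1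
          (hm3 i)).trans (by linarith)
      · exact (uniformTwoNorm_compression_mul_sub (hq.norm_le i) (h1 m) (hq.idempotent i) hm1
          (hm3 i)).trans (by linarith)
      · exact absurd rfl hij
    · refine (uniformTwoNorm_mul_le_of_compressions (hq.norm_le i) (hq.norm_le j) (h1 m)
        (hq.orthogonal i j hne) ?_ ?_).trans (by linarith : 4 * δ ≤ ε)
      · cases b <;> simp
      · cases c <;> simp
  · rintro a ha ⟨i, _ | _⟩
    · exact (uniformTwoNorm_sub_compression_commutator (hq.norm_le i) (h1 m)
        (hq.commutator a ha i) (hm2 a ha)).trans (by linarith)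
    · exact (uniformTwoNorm_compression_commutator (hq.norm_le i) (h1 m)
        (hq.commutator a ha i) (hm2 a ha)).trans (by linarith)
  · rintro a ha ⟨i, _ | _⟩ τ
    · have e : (τ : WeakDual ℂ A) (a * (q i - q i * h m * q i))
          - ((1 - lam) * w i : ℝ) * (τ : WeakDual ℂ A) a
          = ((τ : WeakDual ℂ A) (a * q i) - w i * (τ : WeakDual ℂ A) a)
            - ((τ : WeakDual ℂ A) (a * (q i * h m * q i))
              - (lam * w i : ℝ) * (τ : WeakDual ℂ A) a) := by
        rw [mul_sub, map_sub]
        push_cast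
        ring
      simp only [Bool.false_eq_true, if_false]
      rw [e]
      refine (norm_sub_le _ _).trans ?_
      linarith [hq.trace_mul a ha i τ, htr1 a ha i τ]
    · simp only [if_true]
      linarith [htr1 a ha i τ]
  · rintro ⟨i, _ | _⟩ τ
    · have e : (τ : WeakDual ℂ A) (q i - q i * h m * q i) - ((1 - lam) * w i : ℝ)
          = ((τ : WeakDual ℂ A) (q i) - w i)
            - ((τ : WeakDual ℂ A) (q i * h m * q i) - (lam * w i : ℝ)) := by
        rw [map_sub]
        push_cast
        ring
      simp only [Bool.false_eq_true, if_false]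
      rw [e]
      refine (norm_sub_le _ _).trans ?_
      linarith [hq.trace i τ, htr2 i τ]
    · simp only [if_true]
      linarith [htr2 i τ]

/-- Iterated splitting gives approximate partitions with arbitrarily small weights. -/
lemma exists_hasApproxPartitions (hcpt : IsCompact (TraceSpace A)) {lam : ℝ} (hl0 : 0 < lam)
    (hl1 : lam < 1) {h : ℕ → A} (hh : IsCentralScaling ω lam h) (n : ℕ) :
    ∃ (ι : Type) (_ : Fintype ι) (w : ι → ℝ), HasApproxPartitions A w ∧ (∀ i, 0 < w i) ∧
      ∑ i, w i = 1 ∧ ∀ i, w i ≤ max lam (1 - lam) ^ n := by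
  induction n with
  | zero => exact ⟨Unit, inferInstance, fun _ => 1, hasApproxPartitions_unit hcpt, by simp⟩
  | succ n ih =>
    obtain ⟨ι, _, w, hw, hw0, hw1, hwn⟩ := ih
    refine ⟨ι × Bool, inferInstance, _, hw.prod_bool hl0 hl1 hh, ?_, ?_, ?_⟩
    · rintro ⟨i, _ | _⟩
      · simpa [hw0 i] using hl1
      · simpa [hw0 i] using hl0
    · simp [Fintype.sum_prod_type, ← add_mul, hw1]
    · rintro ⟨i, _ | _⟩ <;> rw [pow_succ'] <;>
        refine mul_le_mul ?_ (hwn i) (hw0 i).le (hl0.le.trans (le_max_left _ _)) <;> simp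

end Partitions

/-! ### Averages of bounded functions over partitions of the unit interval -/

section Averages

open MeasureTheory Filter Topology Set

/-- The half-open intervals `(u i, u i + w i]` of positive lengths `w i` partition `(0, 1]`. -/
structure IsCellPartition {ι : Type*} (u w : ι → ℝ) : Prop where
  pos : ∀ i, 0 < w i
  disjoint : Pairwise (Function.onFun Disjoint fun i => Ioc (u i) (u i + w i))
  iUnion_eq : ⋃ i, Ioc (u i) (u i + w i) = Ioc (0 : ℝ) 1

lemma exists_isCellPartition {ι : Type*} [Fintype ι] {w : ι → ℝ} (hw : ∀ i, 0 < w i)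
    (hw1 : ∑ i, w i = 1) : ∃ u : ι → ℝ, IsCellPartition u w := by
  classical
  suffices ∀ s : Finset ι, ∃ u : ι → ℝ,
      (s : Set ι).PairwiseDisjoint (fun i => Ioc (u i) (u i + w i)) ∧
      ⋃ i ∈ s, Ioc (u i) (u i + w i) = Ioc (0 : ℝ) (∑ i ∈ s, w i) by
    obtain ⟨u, hu, hu'⟩ := this Finset.univ
    refine ⟨u, hw, fun i j hij => hu (by simp) (by simp) hij, ?_⟩
    simpa [hw1] using hu'
  intro s
  induction s using Finset.induction_on with
  | empty => exact ⟨fun _ => 0, by simp, by simp⟩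
  | insert j s hj ih =>
    obtain ⟨u, hu, hu'⟩ := ih
    set v := Function.update u j (∑ i ∈ s, w i) with hv
    have hvs : ∀ i ∈ s, v i = u i := fun i hi => by
      rw [hv, Function.update_of_ne (fun h => hj (by rwa [← h]))]
    have hvj : v j = ∑ i ∈ s, w i := by simp [hv]
    have hU : ⋃ i ∈ s, Ioc (v i) (v i + w i) = Ioc (0 : ℝ) (∑ i ∈ s, w i) := by
      rw [← hu']
      exact iUnion₂_congr fun i hi => by rw [hvs i hi]
    have h0 : 0 ≤ ∑ i ∈ s, w i := Finset.sum_nonneg fun i _ => (hw i).le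
    refine ⟨v, ?_, ?_⟩
    · rw [Finset.coe_insert, Set.pairwiseDisjoint_insert]
      refine ⟨fun i hi i' hi' hii => ?_, fun i hi _ => ?_⟩
      · simpa only [Function.onFun, hvs i hi, hvs i' hi'] using hu hi hi' hii
      · have hsub : Ioc (v i) (v i + w i) ⊆ Ioc (0 : ℝ) (∑ i ∈ s, w i) :=
          hU ▸ subset_biUnion_of_mem (u := fun i => Ioc (v i) (v i + w i)) hi
        refine Disjoint.mono_right hsub ?_
        rw [hvj]
        exact (Ioc_disjoint_Ioc_of_le le_rfl).symm
    · rw [Finset.set_biUnion_insert, hU, hvj, Finset.sum_insert hj, union_comm,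
        Ioc_union_Ioc_eq_Ioc h0 (by linarith [hw j]), add_comm (w j)]

/-- Lebesgue measure on `[0, 1]`. -/
abbrev unitVolume : Measure ℝ := volume.restrict (Icc (0 : ℝ) 1)

/-- The mean value of `f` over the interval `(u, u + w]`. -/
def cellMean (u w : ℝ) (f : LInfty) : ℂ :=
  (w⁻¹ : ℂ) * ∫ t in Ioc u (u + w), f t ∂unitVolume

lemma LInfty.integrable (f : LInfty) : Integrable f unitVolume :=
  (Lp.memLp f).integrable le_top

lemma LInfty.ae_norm_le (f : LInfty) : ∀ᵐ t ∂unitVolume, ‖f t‖ ≤ ‖f‖ := by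
  filter_upwards [ae_le_eLpNormEssSup (f := f) (μ := unitVolume)] with t ht
  rw [Lp.norm_def, eLpNorm_exponent_top, ← toReal_enorm]
  refine ENNReal.toReal_mono ?_ ht
  rw [← eLpNorm_exponent_top]
  exact (Lp.memLp f).2.ne

lemma cellMean_add (u w : ℝ) (f g : LInfty) :
    cellMean u w (f + g) = cellMean u w f + cellMean u w g := by
  rw [cellMean, integral_congr_ae (ae_restrict_of_ae (Lp.coeFn_add f g)), cellMean, cellMean,
    ← mul_add]
  congr 1
  exact integral_add f.integrable.integrableOn g.integrable.integrableOn

lemma cellMean_smul (u w : ℝ) (c : ℂ) (f : LInfty) :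
    cellMean u w (c • f) = c * cellMean u w f := by
  rw [cellMean, integral_congr_ae (ae_restrict_of_ae (Lp.coeFn_smul c f)), cellMean]
  simp only [Pi.smul_apply, smul_eq_mul, integral_const_mul]
  ring

lemma cellMean_star (u w : ℝ) (f : LInfty) :
    cellMean u w (star f) = star (cellMean u w f) := by
  rw [cellMean, integral_congr_ae (ae_restrict_of_ae (LInfty.coeFn_star f)), cellMean]
  simp only [Pi.star_apply, RCLike.star_def, map_mul, map_inv₀, Complex.conj_ofReal]
  rw [integral_conj]

lemma unitVolume_real_le (u : ℝ) {w : ℝ} (hw : 0 ≤ w) :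
    unitVolume.real (Ioc u (u + w)) ≤ w := by
  have h : unitVolume.real (Ioc u (u + w)) ≤ volume.real (Ioc u (u + w)) :=
    ENNReal.toReal_mono (by simp) (Measure.restrict_apply_le _ _)
  simpa [hw] using h

lemma norm_cellMean_le (u : ℝ) {w : ℝ} (hw : 0 < w) (f : LInfty) : ‖cellMean u w f‖ ≤ ‖f‖ := by
  have h : ‖∫ t in Ioc u (u + w), f t ∂unitVolume‖
      ≤ ‖f‖ * unitVolume.real (Ioc u (u + w)) :=
    norm_setIntegral_le_of_norm_le_const_ae (measure_lt_top _ _) 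
      (ae_restrict_of_ae f.ae_norm_le)
  rw [cellMean, norm_mul, norm_inv, Complex.norm_real, Real.norm_of_nonneg hw.le]
  rw [inv_mul_le_iff₀ hw, mul_comm w]
  exact h.trans (mul_le_mul_of_nonneg_left (unitVolume_real_le u hw.le) (norm_nonneg f))

namespace IsCellPartition

variable {ι : Type*} {u w : ι → ℝ}

lemma subset (h : IsCellPartition u w) (i : ι) : Ioc (u i) (u i + w i) ⊆ Ioc (0 : ℝ) 1 :=
  h.iUnion_eq ▸ subset_iUnion (fun i => Ioc (u i) (u i + w i)) i

lemma unitVolume_real (h : IsCellPartition u w) (i : ι) :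
    unitVolume.real (Ioc (u i) (u i + w i)) = w i := by
  rw [measureReal_restrict_apply measurableSet_Ioc,
    inter_eq_left.2 ((h.subset i).trans Ioc_subset_Icc_self)]
  simp [(h.pos i).le]

lemma ae_mem_Ioc : ∀ᵐ t ∂unitVolume, t ∈ Ioc (0 : ℝ) 1 := by
  have h0 : ∀ᵐ t ∂unitVolume, t ≠ 0 := ae_restrict_of_ae (Measure.ae_ne volume 0)
  filter_upwards [h0, ae_restrict_mem measurableSet_Icc] with t ht ht'
  exact ⟨lt_of_le_of_ne ht'.1 ht.symm, ht'.2⟩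

lemma sum_integral (h : IsCellPartition u w) [Fintype ι] {E : Type*}
    [NormedAddCommGroup E] [NormedSpace ℝ E] {f : ℝ → E}
    (hf : Integrable f unitVolume) :
    ∑ i, ∫ t in Ioc (u i) (u i + w i), f t ∂unitVolume = ∫ t, f t ∂unitVolume := by
  rw [← integral_iUnion_fintype (fun i => measurableSet_Ioc) h.disjoint
    fun i => hf.integrableOn, h.iUnion_eq, Measure.restrict_eq_self_of_ae_mem ae_mem_Ioc]

lemma sum_mul_cellMean (h : IsCellPartition u w) [Fintype ι] (f : LInfty) :
    ∑ i, w i * cellMean (u i) (w i) f = ∫ t, f t ∂unitVolume := by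
  rw [← h.sum_integral f.integrable]
  refine Finset.sum_congr rfl fun i _ => ?_
  have : (w i : ℂ) ≠ 0 := by exact_mod_cast (h.pos i).ne'
  rw [cellMean, mul_inv_cancel_left₀ this]

lemma cellMean_one (h : IsCellPartition u w) (i : ι) : cellMean (u i) (w i) 1 = 1 := by
  rw [cellMean, integral_congr_ae (ae_restrict_of_ae LInfty.coeFn_one)]
  simp only [integral_const, measureReal_restrict_apply MeasurableSet.univ, univ_inter,
    h.unitVolume_real]
  have : (w i : ℂ) ≠ 0 := by exact_mod_cast (h.pos i).ne'
  simp [this]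

/-- The function equal to `cellMean (u i) (w i) f` on the cell `(u i, u i + w i]`: the conditional
expectation of `f` on the partition. -/
def stepMean [Fintype ι] (u w : ι → ℝ) (f : LInfty) (t : ℝ) : ℂ :=
  ∑ i, (Ioc (u i) (u i + w i)).indicator (fun _ => cellMean (u i) (w i) f) t

lemma stepMean_eq [Fintype ι] (h : IsCellPartition u w) (f : LInfty) {i : ι} {t : ℝ}
    (ht : t ∈ Ioc (u i) (u i + w i)) : stepMean u w f t = cellMean (u i) (w i) f := by
  classical
  rw [stepMean, Finset.sum_eq_single i, indicator_of_mem ht]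
  · intro j _ hj
    exact indicator_of_notMem (fun h' => (h.disjoint hj).le_bot ⟨h', ht⟩) _
  · simp

lemma exists_mem_cell (h : IsCellPartition u w) {t : ℝ} (ht : t ∈ Ioc (0 : ℝ) 1) :
    ∃ i, t ∈ Ioc (u i) (u i + w i) := by
  rwa [← h.iUnion_eq, mem_iUnion] at ht

lemma measurable_stepMean [Fintype ι] (f : LInfty) : Measurable (stepMean u w f) :=
  Finset.measurable_fun_sum _ fun _ _ => measurable_const.indicator measurableSet_Ioc

lemma norm_stepMean_le [Fintype ι] (h : IsCellPartition u w) (f : LInfty) {t : ℝ}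
    (ht : t ∈ Ioc (0 : ℝ) 1) : ‖stepMean u w f t‖ ≤ ‖f‖ := by
  obtain ⟨i, hi⟩ := h.exists_mem_cell ht
  rw [h.stepMean_eq f hi]
  exact norm_cellMean_le _ (h.pos i) f

end IsCellPartition

open IsCellPartition

variable {ι : ℕ → Type} [∀ k, Fintype (ι k)] {u w : ∀ k, ι k → ℝ}

/-- Lebesgue's differentiation theorem: the step functions of mean values converge almost everywhere
when the mesh of the partitions tends to zero. -/
lemma ae_tendsto_stepMean (h : ∀ k, IsCellPartition (u k) (w k)) {δ : ℕ → ℝ}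
    (hδ : Tendsto δ atTop (𝓝 0)) (hw : ∀ k i, w k i ≤ δ k) (f : LInfty) :
    ∀ᵐ t ∂unitVolume, Tendsto (fun k => stepMean (u k) (w k) f t) atTop (𝓝 (f t)) := by
  have hloc : LocallyIntegrable ((Icc (0 : ℝ) 1).indicator f) volume :=
    ((integrable_indicator_iff measurableSet_Icc).2 f.integrable).locallyIntegrable
  have hleb := IsUnifLocDoublingMeasure.ae_tendsto_average (μ := (volume : Measure ℝ)) hloc 1
  filter_upwards [ae_restrict_of_ae hleb, ae_mem_Ioc] with t ht ht01
  choose i hi using fun k => (h k).exists_mem_cell ht01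
  have hlim : Tendsto (fun k => w k (i k) / 2) atTop (𝓝[>] 0) := by
    refine tendsto_nhdsWithin_iff.2 ⟨?_, Eventually.of_forall fun k => half_pos ((h k).pos _)⟩
    refine squeeze_zero (fun k => (half_pos ((h k).pos _)).le)
      (fun k => (half_le_self ((h k).pos _).le).trans (hw k _)) hδ
  have hball : ∀ k, Metric.closedBall (u k (i k) + w k (i k) / 2) (w k (i k) / 2)
      = Icc (u k (i k)) (u k (i k) + w k (i k)) := fun k => by
    rw [Real.closedBall_eq_Icc]
    congr 1 <;> ring
  have := ht (fun k => u k (i k) + w k (i k) / 2) (fun k => w k (i k) / 2) hlim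
    (Eventually.of_forall fun k => by
      rw [one_mul, hball]
      exact Ioc_subset_Icc_self (hi k))
  rw [indicator_of_mem (Ioc_subset_Icc_self ht01)] at this
  refine this.congr fun k => ?_
  rw [(h k).stepMean_eq f (hi k), hball, setAverage_eq, cellMean,
    integral_Icc_eq_integral_Ioc, setIntegral_indicator measurableSet_Icc,
    Measure.restrict_restrict measurableSet_Ioc]
  simp [((h k).pos _).le]

/-- Taking means over finer and finer partitions is asymptotically multiplicative in `L¹`. -/
lemma tendsto_sum_norm_cellMean_mul_sub (h : ∀ k, IsCellPartition (u k) (w k)) {δ : ℕ → ℝ}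
    (hδ : Tendsto δ atTop (𝓝 0)) (hw : ∀ k i, w k i ≤ δ k) (f g : LInfty) :
    Tendsto (fun k => ∑ i, w k i * ‖cellMean (u k i) (w k i) f * cellMean (u k i) (w k i) g
      - cellMean (u k i) (w k i) (f * g)‖) atTop (𝓝 0) := by
  set G : ℕ → ℝ → ℂ := fun k t => stepMean (u k) (w k) f t * stepMean (u k) (w k) g t - (f * g) t
    with hG
  have hfg : ∀ᵐ t ∂unitVolume, ‖(f * g) t‖ ≤ ‖f‖ * ‖g‖ := by
    filter_upwards [LInfty.coeFn_mul f g, f.ae_norm_le, g.ae_norm_le] with t h1 h2 h3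
    rw [h1, Pi.mul_apply, norm_mul]
    gcongr
  have hGm : ∀ k, AEStronglyMeasurable (G k) unitVolume := fun k =>
    ((measurable_stepMean f).mul (measurable_stepMean g)).aestronglyMeasurable.sub
      (f * g).integrable.aestronglyMeasurable
  have hGb : ∀ k, ∀ᵐ t ∂unitVolume, ‖G k t‖ ≤ ‖f‖ * ‖g‖ + ‖f‖ * ‖g‖ := fun k => by
    filter_upwards [hfg, ae_mem_Ioc] with t h1 h2
    refine (norm_sub_le _ _).trans (add_le_add ?_ h1)
    rw [norm_mul]
    gcongr
    · exact (h k).norm_stepMean_le f h2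
    · exact (h k).norm_stepMean_le g h2
  have hlim : Tendsto (fun k => ∫ t, ‖G k t‖ ∂unitVolume) atTop (𝓝 0) := by
    rw [← integral_zero ℝ ℝ (μ := unitVolume)]
    refine tendsto_integral_of_dominated_convergence _ (fun k => (hGm k).norm)
      (integrable_const (‖f‖ * ‖g‖ + ‖f‖ * ‖g‖)) (fun k => ?_) ?_
    · simpa only [norm_norm] using hGb k
    · filter_upwards [ae_tendsto_stepMean h hδ hw f, ae_tendsto_stepMean h hδ hw g,
        LInfty.coeFn_mul f g] with t h1 h2 h3
      have := ((h1.mul h2).sub_const ((f * g) t)).norm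
      rwa [h3, Pi.mul_apply, sub_self, norm_zero, ← Pi.mul_apply, ← h3] at this
  refine squeeze_zero (fun k => Finset.sum_nonneg fun i _ =>
    mul_nonneg ((h k).pos i).le (norm_nonneg _)) (fun k => ?_) hlim
  have hGi : Integrable (G k) unitVolume :=
    (integrable_const (‖f‖ * ‖g‖ + ‖f‖ * ‖g‖)).mono' (hGm k) (hGb k)
  rw [← (h k).sum_integral hGi.norm]
  refine Finset.sum_le_sum fun i _ => ?_
  have hpos := (h k).pos i
  have hne : (w k i : ℂ) ≠ 0 := by exact_mod_cast hpos.ne'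
  have e : ∫ t in Ioc (u k i) (u k i + w k i), G k t ∂unitVolume
      = w k i * (cellMean (u k i) (w k i) f * cellMean (u k i) (w k i) g
      - cellMean (u k i) (w k i) (f * g)) := by
    have e1 : ∫ t in Ioc (u k i) (u k i + w k i), G k t ∂unitVolume
        = ∫ t in Ioc (u k i) (u k i + w k i), (cellMean (u k i) (w k i) f
          * cellMean (u k i) (w k i) g - (f * g) t) ∂unitVolume := by
      refine setIntegral_congr_fun measurableSet_Ioc fun t ht => ?_
      simp only [hG, (h k).stepMean_eq f ht, (h k).stepMean_eq g ht]
    rw [e1, integral_sub (integrable_const _) (f * g).integrable.integrableOn, setIntegral_const,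
      (h k).unitVolume_real, mul_sub, Complex.real_smul]
    congr 1
    rw [cellMean, mul_inv_cancel_left₀ hne]
  rw [← Real.norm_of_nonneg hpos.le, ← Complex.norm_real, ← norm_mul, Complex.norm_real,
    Real.norm_of_nonneg hpos.le, ← e]
  exact norm_integral_le_integral_norm _

end Averages

/-! ### Linear combinations of approximate partitions -/

section Combinations

open Filter Topology

attribute [local instance] CStarAlgebra.spectralOrder CStarAlgebra.spectralOrderedRing

variable {A : Type*} [NonUnitalCStarAlgebra A] {ι : Type*} [Fintype ι]

/-- The norm of a linear combination of positive elements with sum of norm at most one is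
controlled by the coefficients, independently of the number of terms. -/
lemma norm_sum_smul_le {q : ι → A} (h0 : ∀ i, 0 ≤ q i) (h1 : ‖∑ i, q i‖ ≤ 1) {c : ι → ℂ} {D : ℝ}
    (hD : 0 ≤ D) (hc : ∀ i, ‖c i‖ ≤ D) : ‖∑ i, c i • q i‖ ≤ 4 * D := by
  have hpos : ∀ r : ι → ℝ, (∀ i, 0 ≤ r i) → (∀ i, r i ≤ D) → ‖∑ i, r i • q i‖ ≤ D := by
    intro r hr0 hr1
    have h2 : ∑ i, r i • q i ≤ D • ∑ i, q i := by
      rw [Finset.smul_sum]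
      exact Finset.sum_le_sum fun i _ => smul_le_smul_of_nonneg_right (hr1 i) (h0 i)
    refine (CStarAlgebra.norm_le_norm_of_nonneg_of_le
      (Finset.sum_nonneg fun i _ => smul_nonneg (hr0 i) (h0 i)) h2).trans ?_
    rw [norm_smul, Real.norm_of_nonneg hD]
    exact mul_le_of_le_one_right hD h1
  have hreal : ∀ r : ι → ℝ, (∀ i, |r i| ≤ D) → ‖∑ i, r i • q i‖ ≤ 2 * D := by
    intro r hr
    have e : ∑ i, r i • q i = ∑ i, max (r i) 0 • q i - ∑ i, max (-r i) 0 • q i := by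
      rw [← Finset.sum_sub_distrib]
      refine Finset.sum_congr rfl fun i _ => ?_
      rw [← sub_smul]
      congr 1
      rcases le_total 0 (r i) with h | h
      · rw [max_eq_left h, max_eq_right (by linarith), sub_zero]
      · rw [max_eq_right h, max_eq_left (by linarith)]
        ring
    rw [e]
    refine (norm_sub_le _ _).trans ?_
    have b1 := hpos (fun i => max (r i) 0) (fun i => le_max_right _ _)
      (fun i => max_le ((le_abs_self _).trans (hr i)) hD)
    have b2 := hpos (fun i => max (-r i) 0) (fun i => le_max_right _ _)
      (fun i => max_le ((neg_le_abs _).trans (hr i)) hD)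
    linarith
  have e : ∑ i, c i • q i = ∑ i, (c i).re • q i + Complex.I • ∑ i, (c i).im • q i := by
    rw [Finset.smul_sum, ← Finset.sum_add_distrib]
    refine Finset.sum_congr rfl fun i _ => ?_
    rw [← Complex.coe_smul (c i).re, ← Complex.coe_smul (c i).im, smul_smul, ← add_smul,
      mul_comm Complex.I, Complex.re_add_im]
  rw [e]
  refine (norm_add_le _ _).trans ?_
  rw [norm_smul, Complex.norm_I, one_mul]
  have b1 := hreal (fun i => (c i).re) fun i => (Complex.abs_re_le_norm _).trans (hc i)
  have b2 := hreal (fun i => (c i).im) fun i => (Complex.abs_im_le_norm _).trans (hc i)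
  linarith

namespace IsApproxPartition

variable {w : ι → ℝ} {F : Finset A} {ε η : ℝ} {q : ι → A}

lemma uniformTwoNorm_sum_mul_sum_sub_le (h : IsApproxPartition w F ε q) (hε : 0 ≤ ε)
    (hη : ((Fintype.card ι : ℝ) + 1) ^ 2 * ε ≤ η) {c d : ι → ℂ} {C D : ℝ} (hC : 0 ≤ C)
    (hD : 0 ≤ D) (hc : ∀ i, ‖c i‖ ≤ C) (hd : ∀ i, ‖d i‖ ≤ D) :
    uniformTwoNorm ((∑ i, c i • q i) * (∑ i, d i • q i) - ∑ i, (c i * d i) • q i)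
      ≤ C * D * η := by
  classical
  have e : (∑ i, c i • q i) * (∑ i, d i • q i) - ∑ i, (c i * d i) • q i
      = ∑ i, ∑ j, (c i * d j) • (q i * q j - if i = j then q i else 0) := by
    rw [Finset.sum_mul_sum, ← Finset.sum_sub_distrib]
    refine Finset.sum_congr rfl fun i _ => ?_
    simp [smul_sub, Finset.sum_sub_distrib, smul_mul_smul_comm]
  rw [e]
  have hterm : ∀ i j, uniformTwoNorm ((c i * d j) • (q i * q j - if i = j then q i else 0))
      ≤ C * D * ε := fun i j => by
    refine (uniformTwoNorm_smul_le _ _).trans ?_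
    rw [norm_mul]
    refine mul_le_mul (mul_le_mul (hc i) (hd j) (norm_nonneg _) hC) ?_
      (uniformTwoNorm_nonneg _) (mul_nonneg hC hD)
    rcases eq_or_ne i j with rfl | hij
    · simpa using h.idempotent i
    · simpa [hij] using h.orthogonal i j hij
  have hsum : uniformTwoNorm (∑ i, ∑ j, (c i * d j) • (q i * q j - if i = j then q i else 0))
      ≤ ∑ _i : ι, ∑ _j : ι, C * D * ε :=
    (uniformTwoNorm_sum_le _ _).trans (Finset.sum_le_sum fun i _ =>
      (uniformTwoNorm_sum_le _ _).trans (Finset.sum_le_sum fun j _ => hterm i j))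
  refine hsum.trans ?_
  simp only [Finset.sum_const, Finset.card_univ, nsmul_eq_mul]
  have hn : (0 : ℝ) ≤ Fintype.card ι := Nat.cast_nonneg _
  have h1 : (Fintype.card ι : ℝ) * Fintype.card ι * ε ≤ η :=
    (mul_le_mul_of_nonneg_right (by nlinarith) hε).trans hη
  calc _ = C * D * ((Fintype.card ι : ℝ) * Fintype.card ι * ε) := by ring
    _ ≤ C * D * η := by gcongr

lemma sum_const_le (hε : 0 ≤ ε) (hη : ((Fintype.card ι : ℝ) + 1) ^ 2 * ε ≤ η) {D : ℝ}
    (hD : 0 ≤ D) : ∑ _i : ι, D * ε ≤ D * η := by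
  simp only [Finset.sum_const, Finset.card_univ, nsmul_eq_mul]
  have hn : (0 : ℝ) ≤ Fintype.card ι := Nat.cast_nonneg _
  have h1 : (Fintype.card ι : ℝ) * ε ≤ η :=
    (mul_le_mul_of_nonneg_right (by nlinarith) hε).trans hη
  calc _ = D * ((Fintype.card ι : ℝ) * ε) := by ring
    _ ≤ D * η := by gcongr

lemma norm_apply_sum_sub_le (h : IsApproxPartition w F ε q) (hε : 0 ≤ ε)
    (hη : ((Fintype.card ι : ℝ) + 1) ^ 2 * ε ≤ η) {c : ι → ℂ} {D : ℝ}
    (hD : 0 ≤ D) (hc : ∀ i, ‖c i‖ ≤ D) (τ : TraceSpace A) :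
    ‖(τ : WeakDual ℂ A) (∑ i, c i • q i) - ∑ i, w i * c i‖ ≤ D * η := by
  have e : (τ : WeakDual ℂ A) (∑ i, c i • q i) - ∑ i, w i * c i
      = ∑ i, c i * ((τ : WeakDual ℂ A) (q i) - w i) := by
    rw [map_sum, ← Finset.sum_sub_distrib]
    refine Finset.sum_congr rfl fun i _ => ?_
    rw [map_smul, smul_eq_mul]
    ring
  rw [e]
  refine (norm_sum_le _ _).trans ((Finset.sum_le_sum fun i _ => ?_).trans (sum_const_le hε hη hD))
  rw [norm_mul]
  exact mul_le_mul (hc i) (h.trace i τ) (norm_nonneg _) hD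

lemma norm_apply_mul_sum_sub_le (h : IsApproxPartition w F ε q) (hε : 0 ≤ ε)
    (hη : ((Fintype.card ι : ℝ) + 1) ^ 2 * ε ≤ η) {c : ι → ℂ} {D : ℝ}
    (hD : 0 ≤ D) (hc : ∀ i, ‖c i‖ ≤ D) {a : A} (ha : a ∈ F) (τ : TraceSpace A) :
    ‖(τ : WeakDual ℂ A) (a * ∑ i, c i • q i) - (τ : WeakDual ℂ A) a * ∑ i, w i * c i‖
      ≤ D * η := by
  have e : (τ : WeakDual ℂ A) (a * ∑ i, c i • q i) - (τ : WeakDual ℂ A) a * ∑ i, w i * c i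
      = ∑ i, c i * ((τ : WeakDual ℂ A) (a * q i) - w i * (τ : WeakDual ℂ A) a) := by
    rw [Finset.mul_sum, map_sum, Finset.mul_sum, ← Finset.sum_sub_distrib]
    refine Finset.sum_congr rfl fun i _ => ?_
    rw [mul_smul_comm, map_smul, smul_eq_mul]
    ring
  rw [e]
  refine (norm_sum_le _ _).trans ((Finset.sum_le_sum fun i _ => ?_).trans (sum_const_le hε hη hD))
  rw [norm_mul]
  exact mul_le_mul (hc i) (h.trace_mul a ha i τ) (norm_nonneg _) hD

lemma uniformTwoNorm_commutator_sum_le (h : IsApproxPartition w F ε q) (hε : 0 ≤ ε)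
    (hη : ((Fintype.card ι : ℝ) + 1) ^ 2 * ε ≤ η) {c : ι → ℂ} {D : ℝ}
    (hD : 0 ≤ D) (hc : ∀ i, ‖c i‖ ≤ D) {a : A} (ha : a ∈ F) :
    uniformTwoNorm ((∑ i, c i • q i) * a - a * ∑ i, c i • q i) ≤ D * η := by
  have e : (∑ i, c i • q i) * a - a * ∑ i, c i • q i = ∑ i, c i • (q i * a - a * q i) := by
    rw [Finset.sum_mul, Finset.mul_sum, ← Finset.sum_sub_distrib]
    refine Finset.sum_congr rfl fun i _ => ?_
    rw [smul_mul_assoc, mul_smul_comm, smul_sub]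
  rw [e]
  refine (uniformTwoNorm_sum_le _ _).trans
    ((Finset.sum_le_sum fun i _ => ?_).trans (sum_const_le hε hη hD))
  exact (uniformTwoNorm_smul_le _ _).trans
    (mul_le_mul (hc i) (h.commutator a ha i) (uniformTwoNorm_nonneg _) hD)

/-- The uniform 2-norm of a bounded linear combination is controlled by its weighted `ℓ¹` norm. -/
lemma uniformTwoNorm_sum_smul_le (h : IsApproxPartition w F ε q) (hε : 0 ≤ ε)
    (hη : ((Fintype.card ι : ℝ) + 1) ^ 2 * ε ≤ η) (hw : ∀ i, 0 ≤ w i) {d : ι → ℂ} {D : ℝ}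
    (hD : 0 ≤ D) (hd : ∀ i, ‖d i‖ ≤ D) :
    uniformTwoNorm (∑ i, d i • q i) ≤ √(D * ∑ i, w i * ‖d i‖ + 2 * (D * D * η)) := by
  refine uniformTwoNorm_le (Real.sqrt_nonneg _) fun τ => Real.sqrt_le_sqrt ?_
  have hs : star (∑ i, d i • q i) = ∑ i, star (d i) • q i := by
    rw [star_sum]
    refine Finset.sum_congr rfl fun i _ => ?_
    rw [star_smul, (IsSelfAdjoint.of_nonneg (h.nonneg i)).star_eq]
  have hd' : ∀ i, ‖star (d i)‖ ≤ D := fun i => by rw [norm_star]; exact hd i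
  have b1 := (norm_apply_le_uniformTwoNorm τ _).trans
    (h.uniformTwoNorm_sum_mul_sum_sub_le hε hη hD hD hd' hd)
  have b2 := h.norm_apply_sum_sub_le hε hη (c := fun i => star (d i) * d i) (mul_nonneg hD hD)
    (fun i => by
      rw [norm_mul]
      exact mul_le_mul (hd' i) (hd i) (norm_nonneg _) hD) τ
  have b3 : ‖∑ i, (w i : ℂ) * (star (d i) * d i)‖ ≤ D * ∑ i, w i * ‖d i‖ := by
    rw [Finset.mul_sum]
    refine (norm_sum_le _ _).trans (Finset.sum_le_sum fun i _ => ?_)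
    rw [norm_mul, norm_mul, norm_star, Complex.norm_real, Real.norm_of_nonneg (hw i)]
    calc _ = w i * ‖d i‖ * ‖d i‖ := by ring
      _ ≤ w i * ‖d i‖ * D := mul_le_mul_of_nonneg_left (hd i) (mul_nonneg (hw i) (norm_nonneg _))
      _ = _ := by ring
  refine (Complex.re_le_norm _).trans ?_
  rw [hs]
  have e : (τ : WeakDual ℂ A) ((∑ i, star (d i) • q i) * ∑ i, d i • q i)
      = (τ : WeakDual ℂ A) ((∑ i, star (d i) • q i) * (∑ i, d i • q i)
          - ∑ i, (star (d i) * d i) • q i)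
        + ((τ : WeakDual ℂ A) (∑ i, (star (d i) * d i) • q i)
          - ∑ i, (w i : ℂ) * (star (d i) * d i)) + ∑ i, (w i : ℂ) * (star (d i) * d i) := by
    rw [map_sub]
    ring
  rw [e]
  refine (norm_add₃_le).trans ?_
  linarith

end IsApproxPartition

end Combinations

/-! ### The homomorphism from `L^∞([0,1])` -/

section Homomorphism

open Filter Topology MeasureTheory

attribute [local instance] CStarAlgebra.spectralOrder CStarAlgebra.spectralOrderedRing

variable {A : Type*} [NonUnitalCStarAlgebra A] {ω : Ultrafilter ℕ}

/-- The limit-trace norm dominates the uniform 2-norms of a representing sequence along `ω`. -/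
lemma eventually_uniformTwoNorm_lt {a : BoundedSeq A} {ε : ℝ}
    (h : limitTwoNorm (mk A ω a) < ε) : ∀ᶠ n in (ω : Filter ℕ), uniformTwoNorm (a n) < ε := by
  by_contra hcon
  rw [← Ultrafilter.eventually_not] at hcon
  have h0 : 0 ≤ limitTwoNorm (mk A ω a) := Real.iSup_nonneg fun _ => Real.sqrt_nonneg _
  obtain ⟨c, hc, hcε⟩ := exists_between h
  have hc0 : 0 ≤ c := h0.trans hc.le
  have hne : Nonempty (TraceSpace A) := by
    by_contra hemp
    rw [not_nonempty_iff] at hemp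
    obtain ⟨n, hn⟩ := hcon.exists
    refine hn ((le_of_eq ?_).trans_lt (h0.trans_lt h))
    exact Real.iSup_of_isEmpty _
  have : ∀ n, ∃ τ : TraceSpace A, ¬ uniformTwoNorm (a n) < ε →
      c < twoNorm (τ : WeakDual ℂ A) (a n) := fun n => by
    by_cases hn : uniformTwoNorm (a n) < ε
    · exact ⟨hne.some, fun h' => absurd hn h'⟩
    · obtain ⟨τ, hτ⟩ := exists_lt_of_lt_ciSup (hcε.trans_le (not_lt.1 hn))
      exact ⟨τ, fun _ => hτ⟩
  choose τ hτ using this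
  have hlim := (Complex.continuous_re.tendsto _).comp (tendsto_limitTrace τ (star a * a) (ω := ω))
  have hle : c ^ 2 ≤ (limitTrace ω τ (mk A ω (star a * a))).re := by
    refine ge_of_tendsto hlim (hcon.mono fun n hn => ?_)
    exact (pow_le_pow_left₀ hc0 (hτ n hn).le 2).trans (twoNorm_sq (τ n) (a n)).le
  have h1 : c ≤ twoNorm (limitTrace ω τ) (mk A ω a) := Real.le_sqrt_of_sq_le hle
  exact absurd (h1.trans (le_ciSup (bddAbove_limitTrace (mk A ω a)) ⟨_, τ, rfl⟩)) (not_le.2 hc)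

lemma tendsto_one_div_add_one (hω : (ω : Filter ℕ) ≤ cofinite) :
    Tendsto (fun k : ℕ => 1 / ((k : ℝ) + 1)) ω (𝓝 0) :=
  tendsto_one_div_add_atTop_nhds_zero_nat.mono_left (hω.trans_eq Nat.cofinite_eq_atTop)

/-- Partitions of `(0,1]` of mesh tending to zero together with approximate partitions of `A` with
the same weights, whose total error at stage `k` is at most `1 / (k + 1)`. -/
structure PartitionSequence (A : Type*) [NonUnitalCStarAlgebra A] where
  ofData ::
  /-- The index set of the `k`-th partition. -/
  ι : ℕ → Type
  /-- The index sets are finite. -/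
  fin : ∀ k, Fintype (ι k)
  /-- The left endpoints. -/
  u : ∀ k, ι k → ℝ
  /-- The lengths. -/
  w : ∀ k, ι k → ℝ
  /-- The mesh. -/
  δ : ℕ → ℝ
  /-- The error at stage `k`. -/
  ε : ℕ → ℝ
  /-- The elements with which stage `k` almost commutes. -/
  F : ℕ → Finset A
  /-- The approximate partition at stage `k`. -/
  q : ∀ k, ι k → A
  cells : ∀ k, IsCellPartition (u k) (w k)
  tendsto_mesh : Tendsto δ atTop (𝓝 0)
  length_le : ∀ k i, w k i ≤ δ k
  eps_nonneg : ∀ k, 0 ≤ ε k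
  eps_le : ∀ k, ((Fintype.card (ι k) : ℝ) + 1) ^ 2 * ε k ≤ 1 / ((k : ℝ) + 1)
  approx : ∀ k, IsApproxPartition (w k) (F k) (ε k) (q k)

namespace PartitionSequence

attribute [instance] PartitionSequence.fin

variable (P : PartitionSequence A)

/-- The simple-function approximation of `φ f` at stage `k`. -/
def term (f : LInfty) (k : ℕ) : A := ∑ i, cellMean (P.u k i) (P.w k i) f • P.q k i

lemma norm_cellMean_le (f : LInfty) (k : ℕ) (i : P.ι k) :
    ‖cellMean (P.u k i) (P.w k i) f‖ ≤ ‖f‖ :=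
  UniformGamma.norm_cellMean_le _ ((P.cells k).pos i) f

lemma norm_term_le (f : LInfty) (k : ℕ) : ‖P.term f k‖ ≤ 4 * ‖f‖ :=
  norm_sum_smul_le (P.approx k).nonneg (P.approx k).norm_sum_le_one (norm_nonneg f)
    (P.norm_cellMean_le f k)

/-- The bounded sequence of simple-function approximations. -/
def seq (f : LInfty) : BoundedSeq A := boundedSeq (P.term f) (4 * ‖f‖) (P.norm_term_le f)

lemma seq_apply (f : LInfty) (k : ℕ) : P.seq f k = P.term f k := rfl

lemma seq_add (f g : LInfty) : P.seq (f + g) = P.seq f + P.seq g := by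
  ext k
  rw [lp.coeFn_add, Pi.add_apply]
  simp only [seq_apply, term, cellMean_add, add_smul, Finset.sum_add_distrib]

lemma seq_smul (c : ℂ) (f : LInfty) : P.seq (c • f) = c • P.seq f := by
  ext k
  rw [lp.coeFn_smul, Pi.smul_apply]
  simp only [seq_apply, term, cellMean_smul, mul_smul, Finset.smul_sum]

lemma seq_star (f : LInfty) : P.seq (star f) = star (P.seq f) := by
  ext k
  rw [lp.star_apply]
  simp only [seq_apply, term, cellMean_star, star_sum, star_smul]
  refine Finset.sum_congr rfl fun i _ => ?_
  rw [(IsSelfAdjoint.of_nonneg ((P.approx k).nonneg i)).star_eq]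

lemma mk_seq_mul (hω : (ω : Filter ℕ) ≤ cofinite) (f g : LInfty) :
    mk A ω (P.seq (f * g)) = mk A ω (P.seq f) * mk A ω (P.seq g) := by
  rw [← mk_mul]
  symm
  refine mk_eq_mk_of_tendsto ?_
  set D := ‖f‖ * ‖g‖ + ‖f * g‖
  have hD : 0 ≤ D := by positivity
  set S : ℕ → ℝ := fun k => ∑ i, P.w k i * ‖cellMean (P.u k i) (P.w k i) f
    * cellMean (P.u k i) (P.w k i) g - cellMean (P.u k i) (P.w k i) (f * g)‖
  have hS : Tendsto S ω (𝓝 0) :=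
    (tendsto_sum_norm_cellMean_mul_sub P.cells P.tendsto_mesh P.length_le f g).mono_left
      (hω.trans_eq Nat.cofinite_eq_atTop)
  have hη := tendsto_one_div_add_one hω
  have hlim : Tendsto (fun k : ℕ => ‖f‖ * ‖g‖ * (1 / ((k : ℝ) + 1))
      + √(D * S k + 2 * (D * D * (1 / ((k : ℝ) + 1))))) ω (𝓝 0) := by
    have h2 := ((hS.const_mul D).add ((hη.const_mul (D * D)).const_mul 2)).sqrt
    simpa using (hη.const_mul (‖f‖ * ‖g‖)).add h2
  refine squeeze_zero (fun k => uniformTwoNorm_nonneg _) (fun k => ?_) hlim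
  have e : (P.seq f * P.seq g : BoundedSeq A) k - P.seq (f * g) k
      = ((∑ i, cellMean (P.u k i) (P.w k i) f • P.q k i)
          * (∑ i, cellMean (P.u k i) (P.w k i) g • P.q k i)
          - ∑ i, (cellMean (P.u k i) (P.w k i) f * cellMean (P.u k i) (P.w k i) g) • P.q k i)
        + ∑ i, (cellMean (P.u k i) (P.w k i) f * cellMean (P.u k i) (P.w k i) g
          - cellMean (P.u k i) (P.w k i) (f * g)) • P.q k i := by
    simp only [sub_smul, Finset.sum_sub_distrib]
    rw [lp.infty_coeFn_mul, Pi.mul_apply, seq_apply, seq_apply, seq_apply, term, term, term]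
    abel
  rw [e]
  refine (uniformTwoNorm_add_le _ _).trans (add_le_add ?_ ?_)
  · exact (P.approx k).uniformTwoNorm_sum_mul_sum_sub_le (P.eps_nonneg k) (P.eps_le k)
      (norm_nonneg f) (norm_nonneg g) (P.norm_cellMean_le f k) (P.norm_cellMean_le g k)
  · refine (P.approx k).uniformTwoNorm_sum_smul_le (P.eps_nonneg k) (P.eps_le k)
      (fun i => ((P.cells k).pos i).le) hD fun i => ?_
    refine (norm_sub_le _ _).trans (add_le_add ?_ (P.norm_cellMean_le _ k i))
    rw [norm_mul]
    exact mul_le_mul (P.norm_cellMean_le f k i) (P.norm_cellMean_le g k i) (norm_nonneg _)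
      (norm_nonneg f)

/-- The ⋆-homomorphism `L^∞([0,1]) → A^ω` that sends `f` to the class of its simple-function
approximations. -/
def hom (hω : (ω : Filter ℕ) ≤ cofinite) : LInfty →⋆ₙₐ[ℂ] Ultrapower A ω where
  toFun f := mk A ω (P.seq f)
  map_smul' c f := by rw [seq_smul, map_smul]; rfl
  map_zero' := by
    have := P.seq_smul 0 0
    rw [zero_smul, zero_smul] at this
    rw [this, map_zero]
  map_add' f g := by rw [seq_add, map_add]
  map_mul' f g := P.mk_seq_mul hω f g
  map_star' f := by rw [seq_star, mk_star]

lemma hom_apply (hω : (ω : Filter ℕ) ≤ cofinite) (f : LInfty) :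
    P.hom hω f = mk A ω (P.seq f) := rfl

lemma isIdentity_hom_one (hω : (ω : Filter ℕ) ≤ cofinite) : IsIdentity (P.hom hω 1) := by
  have hterm : ∀ k, P.term 1 k = ∑ i, P.q k i := fun k => by
    simp only [term, (P.cells k).cellMean_one, one_smul]
  have hleft : ∀ x, P.hom hω 1 * x = x := fun x => by
    obtain ⟨b, rfl⟩ := mk_surjective x
    rw [hom_apply, ← mk_mul]
    refine mk_eq_mk_of_tendsto ?_
    have hlim : Tendsto (fun k : ℕ => ‖b‖ * √(1 / ((k : ℝ) + 1))) ω (𝓝 0) := by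
      simpa using (tendsto_one_div_add_one hω).sqrt.const_mul ‖b‖
    refine squeeze_zero (fun k => uniformTwoNorm_nonneg _) (fun k => ?_) hlim
    rw [lp.infty_coeFn_mul, Pi.mul_apply, seq_apply, hterm]
    refine (uniformTwoNorm_mul_sub_le (Finset.sum_nonneg fun i _ => (P.approx k).nonneg i)
      (P.approx k).norm_sum_le_one (ε := 1 / ((k : ℝ) + 1)) (fun τ => ?_) _).trans
      (mul_le_mul_of_nonneg_right (lp.norm_apply_le_norm ENNReal.top_ne_zero b k)
        (Real.sqrt_nonneg _))
    have h1 := (P.approx k).norm_apply_sum_sub_le (P.eps_nonneg k) (P.eps_le k) (c := fun _ => 1)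
      zero_le_one (fun i => by simp) τ
    have hw1 : ∑ i, (P.w k i : ℂ) * 1 = 1 := by
      have := (P.cells k).sum_mul_cellMean 1
      simp only [(P.cells k).cellMean_one] at this
      rw [this, integral_congr_ae LInfty.coeFn_one]
      simp
    simp only [one_smul, hw1, one_mul] at h1
    have h2 := (Complex.abs_re_le_norm _).trans h1
    rw [Complex.sub_re, Complex.one_re] at h2
    linarith [(abs_le.1 h2).1]
  -- a left identity of a ring with involution is self-adjoint
  have hsa : star (P.hom hω 1) = P.hom hω 1 := by
    have h1 := hleft (star (P.hom hω 1))
    have h2 := congrArg star h1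
    rw [star_mul, star_star] at h2
    exact h1.symm.trans h2
  refine fun x => ⟨hleft x, ?_⟩
  rw [← star_star (x * P.hom hω 1), star_mul, hsa, hleft, star_star]

lemma commute_hom {s : ℕ → BoundedSeq A} (hs : ∀ j k, j ≤ k → s j k ∈ P.F k)
    (hω : (ω : Filter ℕ) ≤ cofinite) {x : Ultrapower A ω}
    (hx : ∀ ε : ℝ, 0 < ε → ∃ j, limitTwoNorm (x - mk A ω (s j)) < ε) (f : LInfty) :
    x * P.hom hω f = P.hom hω f * x := by
  obtain ⟨b, rfl⟩ := mk_surjective x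
  rw [hom_apply, ← mk_mul, ← mk_mul]
  symm
  refine mk_eq_mk_of_tendsto ?_
  rw [Metric.tendsto_nhds]
  intro ε hε
  set C := 4 * ‖f‖ + 1
  have hC : 0 < C := by positivity
  have hfC : ∀ k, ‖P.term f k‖ ≤ C := fun k =>
    (P.norm_term_le f k).trans (le_add_of_nonneg_right zero_le_one)
  obtain ⟨j, hj⟩ := hx (ε / (4 * C)) (by positivity)
  rw [← map_sub] at hj
  have hη := ((tendsto_one_div_add_one hω).const_mul ‖f‖).eventually
    (gt_mem_nhds (show ‖f‖ * 0 < ε / 2 by rw [mul_zero]; positivity))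
  have hge : ∀ᶠ k in (ω : Filter ℕ), j ≤ k :=
    (hω.trans_eq Nat.cofinite_eq_atTop) (eventually_ge_atTop j)
  filter_upwards [eventually_uniformTwoNorm_lt hj, hη, hge] with k h1 h2 h3
  rw [lp.coeFn_sub, Pi.sub_apply] at h1
  rw [Real.dist_0_eq_abs, abs_of_nonneg (uniformTwoNorm_nonneg _), lp.infty_coeFn_mul,
    lp.infty_coeFn_mul, Pi.mul_apply, Pi.mul_apply, seq_apply]
  have e : P.term f k * b k - b k * P.term f k = (P.term f k * s j k - s j k * P.term f k)
      + (P.term f k * (b k - s j k) - (b k - s j k) * P.term f k) := by noncomm_ring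
  rw [e]
  have b1 := (P.approx k).uniformTwoNorm_commutator_sum_le (P.eps_nonneg k) (P.eps_le k)
    (norm_nonneg f) (P.norm_cellMean_le f k) (hs j k h3)
  have b2 : ∀ y : A, ‖P.term f k‖ * uniformTwoNorm y ≤ C * uniformTwoNorm y := fun y =>
    mul_le_mul_of_nonneg_right (hfC k) (uniformTwoNorm_nonneg y)
  have b3 := (uniformTwoNorm_mul_le_left (P.term f k) (b k - s j k)).trans (b2 _)
  have b4 := (uniformTwoNorm_mul_le_right (b k - s j k) (P.term f k)).trans (b2 _)
  have b5 : C * uniformTwoNorm (b k - s j k) < ε / 4 := by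
    have := mul_lt_mul_of_pos_left h1 hC
    calc _ < _ := this
      _ = ε / 4 := by field_simp
  have t1 := uniformTwoNorm_add_le (P.term f k * s j k - s j k * P.term f k)
    (P.term f k * (b k - s j k) - (b k - s j k) * P.term f k)
  have t2 := uniformTwoNorm_sub_le (P.term f k * (b k - s j k)) ((b k - s j k) * P.term f k)
  have b1' : uniformTwoNorm (P.term f k * s j k - s j k * P.term f k)
    ≤ ‖f‖ * (1 / ((k : ℝ) + 1)) := b1
  linarith

lemma limitTrace_mul_hom {s : ℕ → BoundedSeq A} (hs : ∀ j k, j ≤ k → s j k ∈ P.F k)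
    (hω : (ω : Filter ℕ) ≤ cofinite) {x : Ultrapower A ω}
    (hx : ∀ ε : ℝ, 0 < ε → ∃ j, limitTwoNorm (x - mk A ω (s j)) < ε) (f : LInfty)
    (τ : ℕ → TraceSpace A) :
    limitTrace ω τ (x * P.hom hω f) = limitTrace ω τ x * ∫ t, f t ∂unitVolume := by
  obtain ⟨b, rfl⟩ := mk_surjective x
  rw [hom_apply, ← mk_mul]
  refine tendsto_nhds_unique (tendsto_limitTrace τ (b * P.seq f)) ?_
  have hb := (tendsto_limitTrace τ b (ω := ω)).mul_const (∫ t, f t ∂unitVolume)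
  refine tendsto_of_tendsto_of_dist hb ?_
  rw [Metric.tendsto_nhds]
  intro ε hε
  set I := ∫ t, f t ∂unitVolume with hI
  set C := 4 * ‖f‖ + ‖I‖ + 1
  have hC : 0 < C := by positivity
  obtain ⟨j, hj⟩ := hx (ε / (2 * C)) (by positivity)
  rw [← map_sub] at hj
  have hη := ((tendsto_one_div_add_one hω).const_mul ‖f‖).eventually
    (gt_mem_nhds (show ‖f‖ * 0 < ε / 2 by rw [mul_zero]; positivity))
  have hge : ∀ᶠ k in (ω : Filter ℕ), j ≤ k :=
    (hω.trans_eq Nat.cofinite_eq_atTop) (eventually_ge_atTop j)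
  filter_upwards [eventually_uniformTwoNorm_lt hj, hη, hge] with k h1 h2 h3
  rw [lp.coeFn_sub, Pi.sub_apply] at h1
  rw [Real.dist_0_eq_abs, abs_of_nonneg dist_nonneg, dist_comm, dist_eq_norm, lp.infty_coeFn_mul,
    Pi.mul_apply, seq_apply]
  have e : (τ k : WeakDual ℂ A) (b k * P.term f k) - (τ k : WeakDual ℂ A) (b k) * I
      = ((τ k : WeakDual ℂ A) (s j k * P.term f k) - (τ k : WeakDual ℂ A) (s j k) * I)
        + ((τ k : WeakDual ℂ A) ((b k - s j k) * P.term f k)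
          - (τ k : WeakDual ℂ A) (b k - s j k) * I) := by
    rw [sub_mul, map_sub, map_sub]
    ring
  rw [e]
  have b1 := (P.approx k).norm_apply_mul_sum_sub_le (P.eps_nonneg k) (P.eps_le k)
    (norm_nonneg f) (P.norm_cellMean_le f k) (hs j k h3) (τ k)
  rw [(P.cells k).sum_mul_cellMean f] at b1
  have b1' : ‖(τ k : WeakDual ℂ A) (s j k * P.term f k) - (τ k : WeakDual ℂ A) (s j k) * I‖
    ≤ ‖f‖ * (1 / ((k : ℝ) + 1)) := b1
  set y := b k - s j k
  have b2 : ‖(τ k : WeakDual ℂ A) (y * P.term f k)‖ ≤ 4 * ‖f‖ * uniformTwoNorm y :=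
    (norm_apply_le_uniformTwoNorm (τ k) _).trans ((uniformTwoNorm_mul_le_right _ _).trans
      (mul_le_mul_of_nonneg_right (P.norm_term_le f k) (uniformTwoNorm_nonneg y)))
  have b3 : ‖(τ k : WeakDual ℂ A) y * I‖ ≤ ‖I‖ * uniformTwoNorm y := by
    rw [norm_mul, mul_comm]
    exact mul_le_mul_of_nonneg_left (norm_apply_le_uniformTwoNorm (τ k) y) (norm_nonneg I)
  have b5 : C * uniformTwoNorm y < ε / 2 := by
    calc _ < _ := mul_lt_mul_of_pos_left h1 hC
      _ = ε / 2 := by field_simp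
  have b6 : 4 * ‖f‖ * uniformTwoNorm y + ‖I‖ * uniformTwoNorm y ≤ C * uniformTwoNorm y := by
    rw [← add_mul]
    exact mul_le_mul_of_nonneg_right (le_add_of_nonneg_right zero_le_one)
      (uniformTwoNorm_nonneg y)
  refine (norm_add_le _ _).trans_lt ?_
  linarith [norm_sub_le ((τ k : WeakDual ℂ A) (y * P.term f k)) ((τ k : WeakDual ℂ A) y * I)]

end PartitionSequence

end Homomorphism

/-! ### The three conditions -/

section Conditions

open Filter Topology MeasureTheory Set

variable {A : Type*} [NonUnitalCStarAlgebra A] {ω : Ultrafilter ℕ}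

lemma exists_partitionSequence (hcpt : IsCompact (TraceSpace A)) {lam : ℝ} (hl0 : 0 < lam)
    (hl1 : lam < 1) {h : ℕ → A} (hh : IsCentralScaling ω lam h) (F : ℕ → Finset A) :
    ∃ P : PartitionSequence A, P.F = F := by
  choose ι fin w hw hw0 hw1 hwn using fun k => exists_hasApproxPartitions hcpt hl0 hl1 hh k
  choose u hu using fun k => exists_isCellPartition (hw0 k) (hw1 k)
  have hε : ∀ k : ℕ, 0 < 1 / ((k : ℝ) + 1) / ((Fintype.card (ι k) : ℝ) + 1) ^ 2 := fun k => by
    positivity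
  choose q hq using fun k => hw k (F k) _ (hε k)
  refine ⟨⟨ι, fin, u, w, fun k => max lam (1 - lam) ^ k, _, F, q, hu, ?_, hwn,
    fun k => (hε k).le, fun k => ?_, hq⟩, rfl⟩
  · exact tendsto_pow_atTop_nhds_zero_of_lt_one (hl0.le.trans (le_max_left _ _))
      (max_lt hl1 (by linarith))
  · rw [mul_div_cancel₀]
    positivity

/-- A central projection scaling all limit traces yields, for each separable subset of `A^ω`, a
copy of `L^∞([0,1])` which commutes with that subset and is independent of it for limit traces. -/
lemma exists_hom_of_isCentralScaling (hcpt : IsCompact (TraceSpace A))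
    (hω : (ω : Filter ℕ) ≤ cofinite) {lam : ℝ} (hl0 : 0 < lam)
    (hl1 : lam < 1) {h : ℕ → A} (hh : IsCentralScaling ω lam h) {S : Set (Ultrapower A ω)}
    (hne : S.Nonempty) (hS : IsTwoNormSeparable S) :
    ∃ φ : LInfty →⋆ₙₐ[ℂ] Ultrapower A ω, IsIdentity (φ 1) ∧
      (∀ f, φ f ∈ centralizer S) ∧
      ∀ s ∈ S, ∀ f : LInfty, ∀ τ ∈ LimitTraces A ω,
        τ (s * φ f) = τ s * ∫ t in Icc (0 : ℝ) 1, f t := by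
  classical
  obtain ⟨D, -, hDc, hD⟩ := hS
  have hDne : D.Nonempty := by
    obtain ⟨x, hx⟩ := hne
    obtain ⟨d, hd, -⟩ := hD x hx 1 one_pos
    exact ⟨d, hd⟩
  obtain ⟨d, rfl⟩ := hDc.exists_eq_range hDne
  choose s hs using fun j => mk_surjective (d j)
  obtain ⟨P, hP⟩ := exists_partitionSequence hcpt hl0 hl1 hh
    fun k => (Finset.range (k + 1)).image fun j => s j k
  have hsF : ∀ j k, j ≤ k → s j k ∈ P.F k := fun j k hjk => by
    rw [hP]
    exact Finset.mem_image_of_mem _ (Finset.mem_range.2 (Nat.lt_succ_of_le hjk))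
  have hdense : ∀ x ∈ S, ∀ ε : ℝ, 0 < ε → ∃ j, limitTwoNorm (x - mk A ω (s j)) < ε := by
    intro x hx ε hε
    obtain ⟨_, ⟨j, rfl⟩, hj⟩ := hD x hx ε hε
    exact ⟨j, by rwa [hs]⟩
  refine ⟨P.hom hω, P.isIdentity_hom_one hω,
    fun f x hx => P.commute_hom hsF hω (hdense x hx) f, ?_⟩
  rintro x hx f _ ⟨τ, rfl⟩
  exact P.limitTrace_mul_hom hsF hω (hdense x hx) f τ

lemma limitTwoNorm_iota_le (a : A) : limitTwoNorm (iota A ω a) ≤ ‖a‖ := by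
  refine Real.iSup_le ?_ (norm_nonneg a)
  rintro ⟨_, τ, rfl⟩
  refine Real.sqrt_le_iff.2 ⟨norm_nonneg a, (Complex.re_le_norm _).trans ?_⟩
  refine le_of_tendsto (tendsto_limitTrace τ (constSeq (star a * a))).norm
    (Eventually.of_forall fun n => ?_)
  refine (norm_apply_le (τ n) (star a * a)).trans ?_
  rw [CStarRing.norm_star_mul_self, sq]

lemma isTwoNormSeparable_range_iota [TopologicalSpace.SeparableSpace A] :
    IsTwoNormSeparable (range (iota A ω)) := by
  obtain ⟨D, hDc, hD⟩ := TopologicalSpace.exists_countable_dense A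
  refine ⟨iota A ω '' D, image_subset_range _ _, hDc.image _, ?_⟩
  rintro _ ⟨a, rfl⟩ ε hε
  obtain ⟨d, hd, hdε⟩ := Metric.mem_closure_iff.1 (hD a) ε hε
  refine ⟨_, mem_image_of_mem _ hd, ?_⟩
  rw [← map_sub]
  exact (limitTwoNorm_iota_le _).trans_lt (by rwa [← dist_eq_norm])

/-- The class in `L^∞([0,1])` of the indicator function of an interval. -/
def cellIndicator (u w : ℝ) : LInfty :=
  indicatorConstLp ∞ (measurableSet_Ioc (a := u) (b := u + w)) (measure_ne_top unitVolume _) 1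

lemma coeFn_cellIndicator (u w : ℝ) :
    ⇑(cellIndicator u w) =ᵐ[unitVolume] (Ioc u (u + w)).indicator fun _ => 1 :=
  indicatorConstLp_coeFn

lemma isStarProjection_cellIndicator (u w : ℝ) : IsStarProjection (cellIndicator u w) := by
  constructor
  · refine Lp.ext ?_
    filter_upwards [LInfty.coeFn_mul (cellIndicator u w) (cellIndicator u w),
      coeFn_cellIndicator u w] with t h1 h2
    rw [h1, Pi.mul_apply, h2]
    by_cases ht : t ∈ Ioc u (u + w) <;> simp [ht]
  · refine Lp.ext ?_
    filter_upwards [LInfty.coeFn_star (cellIndicator u w), coeFn_cellIndicator u w] with t h1 h2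
    rw [h1, Pi.star_apply, h2]
    by_cases ht : t ∈ Ioc u (u + w) <;> simp [ht]

lemma IsCellPartition.integral_cellIndicator {ι : Type*} {u w : ι → ℝ} (h : IsCellPartition u w)
    (i : ι) : ∫ t, cellIndicator (u i) (w i) t ∂unitVolume = w i := by
  rw [integral_congr_ae (coeFn_cellIndicator _ _), integral_indicator measurableSet_Ioc]
  simp only [integral_const, measureReal_restrict_apply MeasurableSet.univ, univ_inter,
    h.unitVolume_real]
  simp

lemma IsCellPartition.sum_cellIndicator {ι : Type*} [Fintype ι] {u w : ι → ℝ}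
    (h : IsCellPartition u w) : ∑ i, cellIndicator (u i) (w i) = 1 := by
  refine Lp.ext ?_
  have hall : ∀ᵐ t ∂unitVolume, ∀ i, cellIndicator (u i) (w i) t
      = (Ioc (u i) (u i + w i)).indicator (fun _ => 1) t :=
    ae_all_iff.2 fun i => coeFn_cellIndicator (u i) (w i)
  filter_upwards [Lp.coeFn_finsetSum Finset.univ fun i => cellIndicator (u i) (w i),
    LInfty.coeFn_one, hall, IsCellPartition.ae_mem_Ioc] with t h1 h2 h3 h4
  obtain ⟨i, hi⟩ := h.exists_mem_cell h4
  rw [h1, h2, Finset.sum_apply, Finset.sum_eq_single i, h3, indicator_of_mem hi]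
  · intro j _ hj
    rw [h3]
    exact indicator_of_notMem (fun h' => (h.disjoint hj).le_bot ⟨h', hi⟩) _
  · simp

/-- The images of the indicator functions of `n` intervals of length `1 / n` witness uniform
property `Γ`. -/
lemma hasUniformPropertyGamma_of_hom (φ : LInfty →⋆ₙₐ[ℂ] Ultrapower A ω)
    (h1 : IsIdentity (φ 1)) (hc : ∀ f, φ f ∈ centralizer (range (iota A ω)))
    (ht : ∀ a : A, ∀ f : LInfty, ∀ τ ∈ LimitTraces A ω,
      τ (iota A ω a * φ f) = τ (iota A ω a) * ∫ t in Icc (0 : ℝ) 1, f t) :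
    HasUniformPropertyGamma A ω := by
  intro n hn
  have hn' : (0 : ℝ) < n := Nat.cast_pos.2 hn
  obtain ⟨u, hu⟩ := exists_isCellPartition (ι := Fin n) (w := fun _ => 1 / (n : ℝ))
    (fun _ => by positivity) (by simp [hn'.ne'])
  refine ⟨fun i => φ (cellIndicator (u i) (1 / n)), fun i => ?_, fun i => hc _, ?_,
    fun a τ hτ i => ?_⟩
  · exact (isStarProjection_cellIndicator _ _).map φ
  · rw [← map_sum, hu.sum_cellIndicator]
    exact h1
  · rw [ht a _ τ hτ, hu.integral_cellIndicator i, mul_comm]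
    norm_num

end Conditions

end UniformGamma

end

theorem proposition2p3 {A : Type*} [NonUnitalCStarAlgebra A] [TopologicalSpace.SeparableSpace A]
    (hne : (UniformGamma.TraceSpace A).Nonempty) (hcpt : IsCompact (UniformGamma.TraceSpace A))
    (ω : Ultrafilter ℕ) (hω : (ω : Filter ℕ) ≤ Filter.cofinite) :
    List.TFAE
      [UniformGamma.HasUniformPropertyGamma A ω,
        ∃ lam : ℝ, 0 < lam ∧ lam < 1 ∧ ∃ p : UniformGamma.Ultrapower A ω,
          IsStarProjection p ∧ p ∈ Set.centralizer (Set.range (UniformGamma.iota A ω)) ∧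
          ∀ (a : A), ∀ τ ∈ UniformGamma.LimitTraces A ω,
            τ (UniformGamma.iota A ω a * p) = (lam : ℂ) * τ (UniformGamma.iota A ω a),
        ∀ S : NonUnitalStarSubalgebra ℂ (UniformGamma.Ultrapower A ω),
          UniformGamma.IsTwoNormSeparable (S : Set (UniformGamma.Ultrapower A ω)) →
          ∃ φ : UniformGamma.LInfty →⋆ₙₐ[ℂ] UniformGamma.Ultrapower A ω,
            UniformGamma.IsIdentity (φ 1) ∧
            (∀ f, φ f ∈ Set.centralizer (S : Set (UniformGamma.Ultrapower A ω))) ∧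
            ∀ s ∈ S, ∀ (f : UniformGamma.LInfty), ∀ τ ∈ UniformGamma.LimitTraces A ω,
              τ (s * φ f) = τ s * ∫ t in Set.Icc (0 : ℝ) 1, f t] := by
  tfae_have 1 → 2 := by
    intro h
    obtain ⟨p, hp, hpA, -, hpt⟩ := h 2 two_pos
    refine ⟨1 / 2, by norm_num, by norm_num, p 0, hp 0, hpA 0, fun a τ hτ => ?_⟩
    rw [hpt a τ hτ 0]
    norm_num
  tfae_have 2 → 3 := by
    rintro ⟨lam, hl0, hl1, p, hp, hpA, hpt⟩ S hS
    obtain ⟨h, hh⟩ := UniformGamma.exists_isCentralScaling hp hpA hpt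
    exact UniformGamma.exists_hom_of_isCentralScaling hcpt hω hl0 hl1 hh ⟨0, S.zero_mem⟩ hS
  tfae_have 3 → 1 := by
    intro h
    have hrange : ((NonUnitalStarAlgHom.range (UniformGamma.iota A ω) :
        NonUnitalStarSubalgebra ℂ (UniformGamma.Ultrapower A ω)) :
        Set (UniformGamma.Ultrapower A ω)) = Set.range (UniformGamma.iota A ω) :=
      NonUnitalStarAlgHom.coe_range _
    obtain ⟨φ, h1, hc, ht⟩ := h (NonUnitalStarAlgHom.range (UniformGamma.iota A ω)) (by
      rw [hrange]
      exact UniformGamma.isTwoNormSeparable_range_iota)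
    rw [hrange] at hc
    exact UniformGamma.hasUniformPropertyGamma_of_hom φ h1 hc fun a f τ hτ =>
      ht _ ⟨a, rfl⟩ f τ hτ
  tfae_finish
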